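/- Let $|\cdot|$ be a norm on $\mathbb{R}^d$ and let $X=(X_j)_{j\in\mathbb{Z}}$ be a stationary regularly varying time series with values in $\mathbb{R}^d$: for all $s\le t$ in $\mathbb{Z}$ the measures $\mathbb{P}(u^{-1}(X_s,\dots,X_t)\in\cdot)/\mathbb{P}(|X_0|>u)$ converge vaguely on $(\mathbb{R}^d)^{[s,t]}\setminus\{0\}$, as $u\to\infty$, to a non-zero measure $\nu_{s,t}$ that is finite on sets bounded away from $0$ (the test functions are the bounded continuous functions with support bounded away from $0$). Let $\nu$ be the tail measure of $X$, that is, the Borel measure on $(\mathbb{R}^d)^{\mathbb{Z}}$ with $\nu(\{0\})=0$ whose image under the projection to the coordinates in $[s,t]$ is $\nu_{s,t}$ on $(\mathbb{R}^d)^{[s,t]}\setminus\{0\}$, for all $s\le t$. Assume that $\nu$ is supported on $\ell_0=\{x\in(\mathbb{R}^d)^{\mathbb{Z}}:\lim_{|j|\to\infty}|x_j|=0\}$. Then $X$ has an index $\alpha>0$ and a tail process $Y=(Y_j)_{j\in\mathbb{Z}}$, i.e. $\mathbb{P}(|Y_0|>y)=y^{-\alpha}$ for $y\ge 1$ and, for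 all $s\le t$, the conditional law of $u^{-1}(X_s,\dots,X_t)$ given $|X_0|>u$ converges weakly to the law of $(Y_s,\dots,Y_t)$ as $u\to\infty$. Moreover, put $\vartheta=\mathbb{P}(\sup_{j\ge1}|Y_j|\le1)$, let $Q$ be a random sequence whose law is that of $Y/\sup_j|Y_j|$ conditionally on $\sup_{j\le-1}|Y_j|\le1$, and let $\nu^*$ be the measure $$\nu^*(H)=\vartheta\int_0^\infty\mathbb{E}[H(rQ)]\,\alpha r^{-\alpha-1}\,\mathrm{d}r ,$$ regarded as a measure on the space $\tilde\ell_0$ of classes of sequences in $\ell_0$ modulo shifts, with the metric $\tilde d(\tilde x,\tilde y)=\inf\{\sup_j|x_j-y_j| : x\in\tilde x,\ y\in\tilde y\}$. Then for every real sequence $c_n\to\infty$ there is a non-decreasing sequence of positive integers $r_n\to\infty$ such that $r_n\mathbb{P}(|X_0|>c_n)\to0$ and the measures on $\tilde\ell_0$ $$\nu_{n,r_n}=\frac{\mathbb{P}\bigl(c_n^{-1}(X_1,\dots,X_{r_n})\in\cdot\bigr)}{r_n\,\mathbb{P}(|X_0|>c_n)}$$ (a finite vector is completed with zeros to a sequence)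 converge to $\nu^*$ in $\mathcal{M}_0$: these measures and $\nu^*$ are finite on the Borel subsets of $\tilde\ell_0$ bounded away from the zero class, and $\int f\,\mathrm{d}\nu_{n,r_n}\to\int f\,\mathrm{d}\nu^*$ for all bounded continuous $f$ on $\tilde\ell_0\setminus\{0\}$ with support bounded away from the zero class. -/

import Mathlib

open Filter Topology MeasureTheory ProbabilityTheory
open scoped ENNReal ZeroAtInfty

namespace TailProcess

section Sequences

variable {E : Type*} [NormedAddCommGroup E]

/-- The space `ℓ₀` of two-sided sequences `x : ℤ → E` with `x j → 0` as `|j| → ∞`, with the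
supremum norm, is Mathlib's `C₀(ℤ, E)` (`ℤ` is discrete).  This is the backshift power `B ^ k`
on it, `(B ^ k x) j = x (j - k)`. -/
def shift (k : ℤ) (x : C₀(ℤ, E)) : C₀(ℤ, E) where
  toFun j := x (j - k)
  continuous_toFun := continuous_of_discreteTopology
  zero_at_infty' := by
    have h := x.zero_at_infty'
    rw [cocompact_eq_cofinite] at h ⊢
    exact h.comp (sub_left_injective (b := k)).tendsto_cofinite

@[simp] theorem shift_apply (k : ℤ) (x : C₀(ℤ, E)) (j : ℤ) : shift k x j = x (j - k) := rfl

theorem shift_shift (k l : ℤ) (x : C₀(ℤ, E)) : shift k (shift l x) = shift (k + l) x := by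
  ext j
  simp [sub_sub]

theorem shift_zero (x : C₀(ℤ, E)) : shift 0 x = x := by
  ext j
  simp

theorem norm_apply_le (x : C₀(ℤ, E)) (j : ℤ) : ‖x j‖ ≤ ‖x‖ := by
  rw [← ZeroAtInftyContinuousMap.norm_toBCF_eq_norm]
  exact x.toBCF.norm_coe_le_norm j

theorem norm_shift_le (k : ℤ) (x : C₀(ℤ, E)) : ‖shift k x‖ ≤ ‖x‖ := by
  rw [← ZeroAtInftyContinuousMap.norm_toBCF_eq_norm]
  exact (BoundedContinuousFunction.norm_le (norm_nonneg x)).2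
    fun j => norm_apply_le x (j - k)

theorem norm_shift (k : ℤ) (x : C₀(ℤ, E)) : ‖shift k x‖ = ‖x‖ := by
  refine le_antisymm (norm_shift_le k x) ?_
  have h := norm_shift_le (-k) (shift k x)
  rwa [shift_shift, neg_add_cancel, shift_zero] at h

theorem dist_shift (k : ℤ) (x y : C₀(ℤ, E)) : dist (shift k x) (shift k y) = dist x y := by
  have h : shift k x - shift k y = shift k (x - y) := by
    ext j
    simp
  rw [dist_eq_norm, dist_eq_norm, h, norm_shift]

/-- Shift equivalence: `x ∼ y` iff `B ^ k x = y` for some `k : ℤ`. -/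
def shiftSetoid (E : Type*) [NormedAddCommGroup E] : Setoid C₀(ℤ, E) where
  r x y := ∃ k : ℤ, shift k x = y
  iseqv :=
    { refl := fun x => ⟨0, shift_zero x⟩
      symm := by
        rintro x y ⟨k, rfl⟩
        exact ⟨-k, by rw [shift_shift, neg_add_cancel, shift_zero]⟩
      trans := by
        rintro x y z ⟨k, rfl⟩ ⟨l, rfl⟩
        exact ⟨l + k, by rw [shift_shift]⟩ }

/-- The space of shift-equivalence classes of sequences in `ℓ₀`. -/
def ClusterSpace (E : Type*) [NormedAddCommGroup E] : Type _ := Quotient (shiftSetoid E)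

/-- The class of a sequence of `ℓ₀`. -/
def ClusterSpace.mk (x : C₀(ℤ, E)) : ClusterSpace E := Quotient.mk (shiftSetoid E) x

theorem ClusterSpace.mk_shift (k : ℤ) (x : C₀(ℤ, E)) :
    ClusterSpace.mk (shift k x) = ClusterSpace.mk x :=
  (Quotient.sound (s := shiftSetoid E) ⟨k, rfl⟩ : ClusterSpace.mk x = _).symm

theorem ClusterSpace.exists_shift {x y : C₀(ℤ, E)} (h : ClusterSpace.mk x = ClusterSpace.mk y) :
    ∃ k : ℤ, shift k x = y :=
  Quotient.exact (s := shiftSetoid E) h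

/-- The distance on classes: the infimum over all pairs of representatives of the supremum
norm of their difference. -/
noncomputable def clusterDist (a b : ClusterSpace E) : ℝ :=
  ⨅ p : {p : C₀(ℤ, E) × C₀(ℤ, E) // ClusterSpace.mk p.1 = a ∧ ClusterSpace.mk p.2 = b},
    ‖p.1.1 - p.1.2‖

theorem clusterDist_le (x y : C₀(ℤ, E)) :
    clusterDist (ClusterSpace.mk x) (ClusterSpace.mk y) ≤ ‖x - y‖ :=
  ciInf_le (f := fun p : {p : C₀(ℤ, E) × C₀(ℤ, E) //
      ClusterSpace.mk p.1 = ClusterSpace.mk x ∧ ClusterSpace.mk p.2 = ClusterSpace.mk y} =>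
      ‖p.1.1 - p.1.2‖) ⟨0, by rintro _ ⟨p, rfl⟩; exact norm_nonneg _⟩ ⟨(x, y), rfl, rfl⟩

theorem exists_lt_of_clusterDist_lt {x y : C₀(ℤ, E)} {c : ℝ}
    (h : clusterDist (ClusterSpace.mk x) (ClusterSpace.mk y) < c) :
    ∃ k : ℤ, ‖x - shift k y‖ < c := by
  have : Nonempty {p : C₀(ℤ, E) × C₀(ℤ, E) //
      ClusterSpace.mk p.1 = ClusterSpace.mk x ∧ ClusterSpace.mk p.2 = ClusterSpace.mk y} :=
    ⟨⟨(x, y), rfl, rfl⟩⟩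
  obtain ⟨⟨⟨a, b⟩, ha, hb⟩, hab⟩ := exists_lt_of_ciInf_lt h
  obtain ⟨k, rfl⟩ := ClusterSpace.exists_shift ha
  obtain ⟨l, rfl⟩ := ClusterSpace.exists_shift hb.symm
  refine ⟨k + l, ?_⟩
  simp only [← dist_eq_norm] at hab ⊢
  rwa [← shift_shift, dist_shift]

noncomputable instance : MetricSpace (ClusterSpace E) where
  dist := clusterDist
  dist_self a := by
    obtain ⟨x, rfl⟩ := Quotient.exists_rep a
    refine le_antisymm ((clusterDist_le x x).trans (by simp)) ?_
    exact Real.iInf_nonneg fun p => norm_nonneg _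
  dist_comm := by
    have key : ∀ a b : ClusterSpace E, clusterDist a b ≤ clusterDist b a := by
      intro a b
      obtain ⟨x, rfl⟩ := Quotient.exists_rep a
      obtain ⟨y, rfl⟩ := Quotient.exists_rep b
      refine le_of_forall_gt fun c hc => ?_
      obtain ⟨k, hk⟩ := exists_lt_of_clusterDist_lt hc
      have h := clusterDist_le (shift k x) y
      rw [ClusterSpace.mk_shift, norm_sub_rev] at h
      exact h.trans_lt hk
    exact fun a b => le_antisymm (key a b) (key b a)
  dist_triangle a b c := by
    obtain ⟨x, rfl⟩ := Quotient.exists_rep a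
    obtain ⟨y, rfl⟩ := Quotient.exists_rep b
    obtain ⟨z, rfl⟩ := Quotient.exists_rep c
    refine le_of_forall_pos_lt_add fun ε hε => ?_
    obtain ⟨k, hk⟩ := exists_lt_of_clusterDist_lt (x := x) (y := y)
      (lt_add_of_pos_right _ (half_pos hε))
    obtain ⟨l, hl⟩ := exists_lt_of_clusterDist_lt (x := y) (y := z)
      (lt_add_of_pos_right _ (half_pos hε))
    have h := clusterDist_le x (shift (k + l) z)
    rw [ClusterSpace.mk_shift] at h
    rw [← dist_eq_norm] at h hk hl
    have h' := dist_triangle x (shift k y) (shift (k + l) z)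
    rw [← shift_shift, dist_shift] at h'
    rw [← shift_shift] at h
    exact lt_of_le_of_lt (h.trans h') (by
      have := add_lt_add hk hl
      refine this.trans_eq ?_
      show _ + _ + (_ + _) = clusterDist (ClusterSpace.mk x) (ClusterSpace.mk y)
        + clusterDist (ClusterSpace.mk y) (ClusterSpace.mk z) + ε
      ring)
  eq_of_dist_eq_zero := by
    intro a b hab
    obtain ⟨x, rfl⟩ := Quotient.exists_rep a
    obtain ⟨y, rfl⟩ := Quotient.exists_rep b
    change clusterDist (ClusterSpace.mk x) (ClusterSpace.mk y) = 0 at hab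
    change ClusterSpace.mk x = ClusterSpace.mk y
    by_cases hx : x = 0
    · subst hx
      have hy : ‖y‖ ≤ 0 := by
        refine le_of_forall_gt fun c hc => ?_
        obtain ⟨k, hk⟩ := exists_lt_of_clusterDist_lt (hab.trans_lt hc)
        rwa [zero_sub, norm_neg, norm_shift] at hk
      rw [norm_le_zero_iff.1 hy]
    obtain ⟨j, hj⟩ : ∃ j, x j ≠ 0 := by
      by_contra! h
      exact hx (by ext j; simpa using h j)
    have hpos : 0 < ‖x j‖ := norm_pos_iff.2 hj
    have hyt : Tendsto y cofinite (𝓝 0) := by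
      have h := y.zero_at_infty'
      rwa [cocompact_eq_cofinite] at h
    -- only finitely many shifts of `y` are at distance less than `‖x j‖ / 2` from `x`
    have hfin : {k : ℤ | ‖x - shift k y‖ < ‖x j‖ / 2}.Finite := by
      have h1 : {i : ℤ | ‖x j‖ / 2 ≤ ‖y i‖}.Finite := by
        have h := (tendsto_zero_iff_norm_tendsto_zero.1 hyt).eventually_lt_const (half_pos hpos)
        rw [Filter.eventually_cofinite] at h
        simpa only [not_lt] using h
      refine (h1.image fun i => j - i).subset fun k hk => ⟨j - k, ?_, by simp⟩
      have h2 : ‖x j - y (j - k)‖ ≤ ‖x - shift k y‖ := norm_apply_le (x - shift k y) j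
      have h3 := norm_sub_norm_le (x j) (y (j - k))
      have h4 : ‖x - shift k y‖ < ‖x j‖ / 2 := hk
      show ‖x j‖ / 2 ≤ ‖y (j - k)‖
      linarith
    obtain ⟨k₀, hk₀⟩ := exists_lt_of_clusterDist_lt (hab.trans_lt (half_pos hpos))
    obtain ⟨k, hk, hmin⟩ := Set.exists_min_image _ (fun k => ‖x - shift k y‖) hfin ⟨k₀, hk₀⟩
    have hzero : ‖x - shift k y‖ ≤ 0 := by
      by_contra! hlt
      obtain ⟨l, hl⟩ := exists_lt_of_clusterDist_lt (hab.trans_lt hlt)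
      exact absurd (hmin l (hl.trans hk)) (not_le.2 hl)
    rw [sub_eq_zero.1 (norm_le_zero_iff.1 hzero), ClusterSpace.mk_shift]

noncomputable instance : MeasurableSpace (ClusterSpace E) := borel _

instance : BorelSpace (ClusterSpace E) := ⟨rfl⟩

/-- `x* = sup_j ‖x_j‖`, which is the same for all representatives of a class. -/
noncomputable def ClusterSpace.sup (a : ClusterSpace E) : ℝ :=
  Quotient.lift (s := shiftSetoid E) (fun x : C₀(ℤ, E) => ‖x‖)
    (by rintro x _ ⟨k, rfl⟩; exact (norm_shift k x).symm) a

/-- The set `ℓ₀` of sequences tending to zero at infinity, as a subset of `ℤ → E`. -/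
def ell0 (E : Type*) [NormedAddCommGroup E] : Set (ℤ → E) := {x | Tendsto x cofinite (𝓝 0)}

open Classical in
/-- The shift-equivalence class of a sequence in `ℓ₀`.  Sequences outside `ℓ₀` are sent to the
zero class; the function is only used with measures carried by `ℓ₀`. -/
noncomputable def toCluster (x : ℤ → E) : ClusterSpace E :=
  if h : x ∈ ell0 E then
    ClusterSpace.mk ⟨⟨x, continuous_of_discreteTopology⟩, by
      rw [cocompact_eq_cofinite]
      exact h⟩
  else ClusterSpace.mk 0

/-- `μ` is finite on the Borel sets bounded away from the zero class. -/
def IsBoundedlyFinite (μ : Measure (ClusterSpace E)) : Prop :=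
  ∀ A : Set (ClusterSpace E), MeasurableSet A → (∃ ε > 0, ∀ a ∈ A, ε < a.sup) → μ A < ∞

/-- Convergence in `M₀`.  Both the membership in `M₀` and the integrals only see the measures
on the complement of the zero class: a bounded continuous function on this complement with
support bounded away from zero is the same as a bounded continuous function on the whole space
that vanishes on some ball around zero. -/
def TendstoM0 (μ : ℕ → Measure (ClusterSpace E)) (μ' : Measure (ClusterSpace E)) : Prop :=
  (∀ n, IsBoundedlyFinite (μ n)) ∧ IsBoundedlyFinite μ' ∧
    ∀ f : BoundedContinuousFunction (ClusterSpace E) ℝ,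
      (∃ ε > 0, ∀ a : ClusterSpace E, a.sup ≤ ε → f a = 0) →
        Tendsto (fun n => ∫ a, f a ∂(μ n)) atTop (𝓝 (∫ a, f a ∂μ'))

end Sequences

section Series

variable {Ω : Type*} [MeasurableSpace Ω] {E : Type*} [NormedAddCommGroup E] [NormedSpace ℝ E]
  [MeasurableSpace E]

/-- Strict stationarity. -/
def IsStationary (P : Measure Ω) (X : ℤ → Ω → E) : Prop :=
  P.map (fun ω j => X (j + 1) ω) = P.map (fun ω j => X j ω)

/-- `m` is a non-zero measure on `E ^ [s,t] ∖ {0}` (encoded as a measure on `E ^ [s,t]` without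
mass at zero), finite on sets bounded away from zero, and
`P ((X_s, …, X_t) / u ∈ ·) / P (‖X_0‖ > u)` converges vaguely to `m` on `E ^ [s,t] ∖ {0}` as
`u → ∞`, the test functions being the bounded continuous functions with support bounded away
from zero. -/
structure IsTailLimit (P : Measure Ω) (X : ℤ → Ω → E) (s t : ℤ)
    (m : Measure (Set.Icc s t → E)) : Prop where
  ne_zero : m ≠ 0
  zero : m {0} = 0
  finite : ∀ ε > 0, m {x | ε < ‖x‖} < ∞
  tendsto : ∀ f : BoundedContinuousFunction (Set.Icc s t → E) ℝ,
    (∃ ε > 0, ∀ x, ‖x‖ ≤ ε → f x = 0) →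
      Tendsto (fun u : ℝ => (∫ ω, f (fun j => u⁻¹ • X j ω) ∂P) / P.real {ω | u < ‖X 0 ω‖})
        atTop (𝓝 (∫ x, f x ∂m))

/-- Regular variation of the series `X`. -/
def IsRegularlyVarying (P : Measure Ω) (X : ℤ → Ω → E) : Prop :=
  ∀ s t : ℤ, s ≤ t → ∃ m : Measure (Set.Icc s t → E), IsTailLimit P X s t m

/-- `ν` is the tail measure of `X`: it has no mass at the zero sequence, and on
`E ^ [s,t] ∖ {0}` its image under the projection to the coordinates in `[s,t]` is the limit
measure of `(X_s, …, X_t)`. -/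
structure IsTailMeasure (P : Measure Ω) (X : ℤ → Ω → E) (ν : Measure (ℤ → E)) : Prop where
  zero : ν {0} = 0
  proj : ∀ s t : ℤ, s ≤ t →
    IsTailLimit P X s t ((ν.map fun y (j : Set.Icc s t) => y j).restrict {0}ᶜ)

/-- `μY` is the law of the tail process `Y` of `X`, with index `α`: `P (‖Y_0‖ > y) = y ^ (-α)`
for `y ≥ 1`, and the finite-dimensional distributions of `X / u` given `‖X_0‖ > u` converge
weakly to those of `Y` as `u → ∞`. -/
structure IsTailProcess (P : Measure Ω) (X : ℤ → Ω → E) (α : ℝ) (μY : Measure (ℤ → E)) :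
    Prop where
  prob : IsProbabilityMeasure μY
  pareto : ∀ y : ℝ, 1 ≤ y → μY {x | y < ‖x 0‖} = ENNReal.ofReal (y ^ (-α))
  tendsto : ∀ s t : ℤ, s ≤ t → ∀ f : BoundedContinuousFunction (Set.Icc s t → E) ℝ,
    Tendsto (fun u : ℝ => ∫ ω, f (fun j => u⁻¹ • X j ω) ∂(P[|{ω | u < ‖X 0 ω‖}]))
      atTop (𝓝 (∫ y, f (fun j => y j) ∂μY))

/-- The candidate extremal index `ϑ = P (sup_{j ≥ 1} ‖Y_j‖ ≤ 1)`. -/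
noncomputable def extremalIndex (μY : Measure (ℤ → E)) : ℝ≥0∞ :=
  μY {y | ∀ j : ℤ, 1 ≤ j → ‖y j‖ ≤ 1}

/-- The law of the sequence `Q`: the law of `Y / Y*`, with `Y* = sup_j ‖Y_j‖`, conditionally on
`sup_{j ≤ -1} ‖Y_j‖ ≤ 1`. -/
noncomputable def lawQ (μY : Measure (ℤ → E)) : Measure (ℤ → E) :=
  (μY[|{y : ℤ → E | ∀ j : ℤ, j ≤ -1 → ‖y j‖ ≤ 1}]).map fun y => (⨆ j, ‖y j‖)⁻¹ • y

/-- The measure `α r ^ (-α - 1) dr` on `(0, ∞)`. -/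
noncomputable def radialMeasure (α : ℝ) : Measure ℝ :=
  (volume.restrict (Set.Ioi 0)).withDensity fun r => ENNReal.ofReal (α * r ^ (-α - 1))

/-- The measure `ν*` on sequences, `ν* (H) = ϑ ∫₀^∞ E[H (r Q)] α r ^ (-α - 1) dr`. -/
noncomputable def nuStarSeq (α : ℝ) (μY : Measure (ℤ → E)) : Measure (ℤ → E) :=
  extremalIndex μY • ((radialMeasure α).prod (lawQ μY)).map fun p => p.1 • p.2

/-- The measure `ν*` on shift-equivalence classes. -/
noncomputable def nuStar (α : ℝ) (μY : Measure (ℤ → E)) : Measure (ClusterSpace E) :=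
  (nuStarSeq α μY).map toCluster

/-- The rescaled cluster `c⁻¹ (X_1, …, X_r)`, completed with zeros. -/
noncomputable def cluster (X : ℤ → Ω → E) (c : ℝ) (r : ℕ) (ω : Ω) : ℤ → E :=
  fun j => if 1 ≤ j ∧ j ≤ (r : ℤ) then c⁻¹ • X j ω else 0

/-- The normalized cluster measure `P (c⁻¹ X_{1,r} ∈ ·) / (r P (‖X_0‖ > c))` on classes. -/
noncomputable def clusterMeasure (P : Measure Ω) (X : ℤ → Ω → E) (c : ℝ) (r : ℕ) :
    Measure (ClusterSpace E) :=
  ((r : ℝ≥0∞) * P {ω | c < ‖X 0 ω‖})⁻¹ • P.map fun ω => toCluster (cluster X c r ω)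

end Series

end TailProcess

/-! Everything is read off from the tail measure `ν`. Stationarity makes `ν` shift invariant
(`IsTailMeasure.map_seqShift`). Normalizing by `P(‖X_0‖ > u)` or by `P(‖X_0‖ > cu)` changes limits
by a factor that is multiplicative and monotone in `c`, hence a power; this gives the index `α` and
shows that scaling by `c` maps `ν` to `c ^ α • ν` (`IsTailMeasure.exists_index`,
`IsTailMeasure.map_smul`). The law of the tail process is `ν` restricted to `{1 < ‖y 0‖}`
(`IsTailMeasure.isTailProcess`).

The cluster convergence consists of two limits and a diagonal argument. For a fixed window `[1, r]`,
regular variation alone gives convergence to `r⁻¹` times the image of `ν` under truncation to the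
window (`tendstoIntegrals_clusterMeasure`). Now let `r` grow and let `f` vanish on classes with
supremum at most `ε`. Splitting according to the first exceedance of `ε` in the window, and moving
it to time zero by shift invariance, turns the integral of `f` into an average over `j < r` of
integrals with window `[-j, r-1-j]`. For most `j` both ends are far away, and since `ν` lives on
`ℓ₀` each such term is close to the integral of `f` over `firstExc E ε`, the set where time zero is
the first exceedance of `ε` (`tendsto_integral_tailClusterMeasure`).

That this limit is the integral against `ν*` is `lintegral_nuStar`. Its engine is mass exchange
(`setLIntegral_anchor_eq`): a shift-invariant function has the same integral over any two ways of
selecting one representative per orbit. Exchanging last for first exceedances shows that `ϑ` is the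
`ν`-mass of `firstExc E 1`, so `ϑ` times the law of `Q` is the normalized image of `ν` there. Polar
coordinates, homogeneity and an exchange of the level `t` for `ε` do the rest.

Finally, `M₀`-convergence is weak convergence of countably many weighted finite measures, a
pseudometrizable notion, so `r_n` can be chosen to grow slowly enough to combine both limits and to
keep `r_n P(‖X_0‖ > c_n)` small (`exists_diagonal_tendstoM0`). The freedom to choose `r_n` replaces
any anticlustering condition. -/

namespace TailProcess

/-! ### Truncation, and the topology and measurability of the class map -/

section Truncation

variable {E : Type*} [NormedAddCommGroup E]

/-- The sequence that agrees with `y` on `[a, b]` and vanishes elsewhere. -/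
def trunc (a b : ℤ) (y : ℤ → E) : ℤ → E := fun j => if a ≤ j ∧ j ≤ b then y j else 0

theorem trunc_apply_of_mem {a b j : ℤ} (h : a ≤ j ∧ j ≤ b) (y : ℤ → E) : trunc a b y j = y j :=
  if_pos h

theorem trunc_apply_of_not_mem {a b j : ℤ} (h : ¬(a ≤ j ∧ j ≤ b)) (y : ℤ → E) :
    trunc a b y j = 0 :=
  if_neg h

theorem trunc_trunc (a b a' b' : ℤ) (ha : a' ≤ a) (hb : b ≤ b') (y : ℤ → E) :
    trunc a b (trunc a' b' y) = trunc a b y := by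
  ext j
  unfold trunc
  split_ifs <;> first | rfl | omega

theorem continuous_trunc (a b : ℤ) : Continuous (trunc a b : (ℤ → E) → ℤ → E) := by
  refine continuous_pi fun j => ?_
  by_cases h : a ≤ j ∧ j ≤ b
  · simpa only [trunc_apply_of_mem h] using continuous_apply j
  · simpa only [trunc_apply_of_not_mem h] using continuous_const

theorem tendsto_trunc (y : ℤ → E) :
    Tendsto (fun n : ℕ => trunc (-n) n y) atTop (𝓝 y) := by
  refine tendsto_pi_nhds.2 fun j => tendsto_const_nhds.congr' ?_
  filter_upwards [eventually_ge_atTop j.natAbs] with n hn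
  rw [trunc_apply_of_mem (by omega)]

theorem trunc_mem_ell0 (a b : ℤ) (y : ℤ → E) : trunc a b y ∈ ell0 E := by
  refine tendsto_const_nhds.congr' ?_
  rw [EventuallyEq, eventually_cofinite]
  refine (Set.finite_Icc a b).subset fun j hj => ?_
  by_contra h
  exact hj (trunc_apply_of_not_mem h y).symm

theorem shift_mem_ell0 {y : ℤ → E} (hy : y ∈ ell0 E) (k : ℤ) : (fun j => y (j - k)) ∈ ell0 E :=
  Tendsto.comp (show Tendsto y cofinite (𝓝 0) from hy)
    (sub_left_injective (b := k)).tendsto_cofinite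

theorem shift_mem_ell0_iff {y : ℤ → E} (k : ℤ) : (fun j => y (j - k)) ∈ ell0 E ↔ y ∈ ell0 E := by
  refine ⟨fun h => ?_, fun h => shift_mem_ell0 h k⟩
  simpa using shift_mem_ell0 h (-k)

/-- A sequence of `ℓ₀` as an element of `C₀(ℤ, E)`. -/
def ofEll0 (y : ℤ → E) (hy : y ∈ ell0 E) : C₀(ℤ, E) :=
  ⟨⟨y, continuous_of_discreteTopology⟩, by rw [cocompact_eq_cofinite]; exact hy⟩

theorem coe_mem_ell0 (x : C₀(ℤ, E)) : (x : ℤ → E) ∈ ell0 E := by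
  have h := x.zero_at_infty'
  rwa [cocompact_eq_cofinite] at h

theorem toCluster_of_mem {y : ℤ → E} (hy : y ∈ ell0 E) :
    toCluster y = ClusterSpace.mk (ofEll0 y hy) := dif_pos hy

theorem toCluster_of_not_mem {y : ℤ → E} (hy : y ∉ ell0 E) :
    toCluster y = ClusterSpace.mk 0 := dif_neg hy

theorem toCluster_shift (y : ℤ → E) (k : ℤ) : toCluster (fun j => y (j - k)) = toCluster y := by
  by_cases hy : y ∈ ell0 E
  · rw [toCluster_of_mem hy, toCluster_of_mem (shift_mem_ell0 hy k),
      ← ClusterSpace.mk_shift k (ofEll0 y hy)]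
    congr 1
  · rw [toCluster_of_not_mem hy, toCluster_of_not_mem (by rwa [shift_mem_ell0_iff])]

theorem norm_C0_le {x : C₀(ℤ, E)} {c : ℝ} (hc : 0 ≤ c) (h : ∀ j, ‖x j‖ ≤ c) : ‖x‖ ≤ c := by
  rw [← ZeroAtInftyContinuousMap.norm_toBCF_eq_norm]
  exact (BoundedContinuousFunction.norm_le hc).2 h

theorem ClusterSpace.sup_mk (x : C₀(ℤ, E)) : (ClusterSpace.mk x).sup = ‖x‖ := rfl

theorem ClusterSpace.exists_mk (a : ClusterSpace E) : ∃ x, ClusterSpace.mk x = a :=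
  Quotient.exists_rep a

theorem ClusterSpace.sup_nonneg (a : ClusterSpace E) : 0 ≤ a.sup := by
  obtain ⟨x, rfl⟩ := a.exists_mk
  exact norm_nonneg x

theorem dist_mk_le (x y : C₀(ℤ, E)) : dist (ClusterSpace.mk x) (ClusterSpace.mk y) ≤ ‖x - y‖ :=
  clusterDist_le x y

theorem ClusterSpace.sup_le_add_dist (a b : ClusterSpace E) : a.sup ≤ b.sup + dist a b := by
  obtain ⟨x, rfl⟩ := a.exists_mk
  obtain ⟨y, rfl⟩ := b.exists_mk
  refine le_of_forall_pos_lt_add fun δ hδ => ?_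
  obtain ⟨k, hk⟩ := exists_lt_of_clusterDist_lt (x := x) (y := y) (lt_add_of_pos_right _ hδ)
  have h1 := norm_sub_norm_le x (shift k y)
  rw [norm_shift] at h1
  change ‖x‖ < ‖y‖ + clusterDist _ _ + δ
  linarith

theorem ClusterSpace.lipschitzWith_sup : LipschitzWith 1 (ClusterSpace.sup : ClusterSpace E → ℝ) :=
  LipschitzWith.of_le_add fun a b => a.sup_le_add_dist b

theorem ClusterSpace.continuous_sup : Continuous (ClusterSpace.sup : ClusterSpace E → ℝ) :=
  ClusterSpace.lipschitzWith_sup.continuous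

theorem sup_toCluster_le_iff {y : ℤ → E} (hy : y ∈ ell0 E) {s : ℝ} (hs : 0 ≤ s) :
    (toCluster y).sup ≤ s ↔ ∀ j, ‖y j‖ ≤ s := by
  rw [toCluster_of_mem hy, ClusterSpace.sup_mk]
  exact ⟨fun h j => (norm_apply_le (ofEll0 y hy) j).trans h, fun h => norm_C0_le hs h⟩

theorem lt_sup_toCluster_iff {y : ℤ → E} (hy : y ∈ ell0 E) {s : ℝ} (hs : 0 ≤ s) :
    s < (toCluster y).sup ↔ ∃ j, s < ‖y j‖ := by
  rw [← not_le, sup_toCluster_le_iff hy hs]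
  push Not
  rfl

theorem iSup_norm_eq {y : ℤ → E} (hy : y ∈ ell0 E) : ⨆ j, ‖y j‖ = (toCluster y).sup := by
  have hb : ∀ j, ‖y j‖ ≤ (toCluster y).sup :=
    (sup_toCluster_le_iff hy (ClusterSpace.sup_nonneg _)).1 le_rfl
  refine le_antisymm (ciSup_le hb) ((sup_toCluster_le_iff hy ?_).2 fun j => ?_)
  · exact Real.iSup_nonneg fun j => norm_nonneg _
  · exact le_ciSup (f := fun j => ‖y j‖) ⟨_, Set.forall_mem_range.2 hb⟩ j

theorem dist_toCluster_le {x y : ℤ → E} (hx : x ∈ ell0 E) (hy : y ∈ ell0 E) {c : ℝ} (hc : 0 ≤ c)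
    (h : ∀ j, ‖x j - y j‖ ≤ c) : dist (toCluster x) (toCluster y) ≤ c := by
  rw [toCluster_of_mem hx, toCluster_of_mem hy]
  exact (dist_mk_le _ _).trans (norm_C0_le hc h)

/-- On a finite window, pointwise and uniform convergence agree. Without truncation, `toCluster` is
in general not continuous for the product topology: a unit bump moving to infinity tends pointwise
to zero. -/
theorem continuous_toCluster_trunc (a b : ℤ) :
    Continuous fun y : ℤ → E => toCluster (trunc a b y) := by
  rw [continuous_iff_continuousAt]
  intro y
  rw [ContinuousAt, tendsto_iff_dist_tendsto_zero]
  have hle : ∀ x : ℤ → E, dist (toCluster (trunc a b x)) (toCluster (trunc a b y))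
      ≤ ∑ j ∈ Finset.Icc a b, ‖x j - y j‖ := by
    intro x
    refine dist_toCluster_le (trunc_mem_ell0 a b x) (trunc_mem_ell0 a b y)
      (Finset.sum_nonneg fun _ _ => norm_nonneg _) fun j => ?_
    by_cases h : a ≤ j ∧ j ≤ b
    · rw [trunc_apply_of_mem h, trunc_apply_of_mem h]
      exact Finset.single_le_sum (f := fun j => ‖x j - y j‖) (fun _ _ => norm_nonneg _)
        (Finset.mem_Icc.2 h)
    · rw [trunc_apply_of_not_mem h, trunc_apply_of_not_mem h, sub_zero, norm_zero]
      exact Finset.sum_nonneg fun _ _ => norm_nonneg _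
  refine squeeze_zero (fun _ => dist_nonneg) hle ?_
  have hc : Continuous fun x : ℤ → E => ∑ j ∈ Finset.Icc a b, ‖x j - y j‖ := by fun_prop
  simpa using hc.tendsto y

/-- Truncations of a sequence of `ℓ₀` converge to it in the space of classes. -/
theorem tendsto_toCluster_trunc {y : ℤ → E} (hy : y ∈ ell0 E) :
    Tendsto (fun p : ℕ × ℕ => toCluster (trunc (-p.1) p.2 y)) (atTop ×ˢ atTop)
      (𝓝 (toCluster y)) := by
  rw [Metric.tendsto_nhds]
  intro ε hε
  have hfin : {j : ℤ | ¬ ‖y j‖ < ε / 2}.Finite := by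
    have h := (tendsto_zero_iff_norm_tendsto_zero.1
      (show Tendsto y cofinite (𝓝 0) from hy)).eventually_lt_const (half_pos hε)
    rwa [eventually_cofinite] at h
  obtain ⟨N, hN⟩ := (hfin.image Int.natAbs).bddAbove
  filter_upwards [(eventually_ge_atTop N).prod_mk (eventually_ge_atTop N)] with p hp
  refine lt_of_le_of_lt (dist_toCluster_le (trunc_mem_ell0 _ _ y) hy (half_pos hε).le fun j => ?_)
    (half_lt_self hε)
  by_cases h : -(p.1 : ℤ) ≤ j ∧ j ≤ p.2
  · rw [trunc_apply_of_mem h, sub_self, norm_zero]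
    exact (half_pos hε).le
  · rw [trunc_apply_of_not_mem h, zero_sub, norm_neg]
    by_contra! hlt
    have := hN ⟨j, not_lt.2 hlt.le, rfl⟩
    obtain ⟨h1, h2⟩ := hp
    omega

theorem tendsto_toCluster_trunc_nat {y : ℤ → E} (hy : y ∈ ell0 E) :
    Tendsto (fun n : ℕ => toCluster (trunc (-n) n y)) atTop (𝓝 (toCluster y)) := by
  have h : Tendsto (fun n : ℕ => (n, n)) atTop (atTop ×ˢ atTop) := tendsto_id.prodMk tendsto_id
  have h' := (tendsto_toCluster_trunc hy).comp h
  unfold Function.comp at h'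
  exact h'

theorem toCluster_coe (x : C₀(ℤ, E)) : toCluster (x : ℤ → E) = ClusterSpace.mk x :=
  toCluster_of_mem (coe_mem_ell0 x)

/-- Truncated sequences form a countable union of continuous images of a separable space, and they
are dense because every element of `ℓ₀` is the uniform limit of its truncations. -/
instance [SecondCountableTopology E] : SecondCountableTopology (ClusterSpace E) := by
  have : TopologicalSpace.SeparableSpace (ClusterSpace E) := by
    have hs : TopologicalSpace.IsSeparable
        (⋃ n : ℕ, Set.range fun y : ℤ → E => toCluster (trunc (-n) n y)) :=
      .iUnion fun n => TopologicalSpace.isSeparable_range (continuous_toCluster_trunc _ _)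
    rw [← TopologicalSpace.isSeparable_univ_iff]
    refine hs.closure.mono fun a _ => ?_
    obtain ⟨x, rfl⟩ := a.exists_mk
    rw [← toCluster_coe]
    refine mem_closure_of_tendsto (tendsto_toCluster_trunc_nat (coe_mem_ell0 x))
      (Eventually.of_forall fun n => Set.mem_iUnion.2 ⟨n, x, rfl⟩)
  exact UniformSpace.secondCountable_of_separable _

section Measurability

variable [MeasurableSpace E] [BorelSpace E]

theorem measurableSet_ell0 : MeasurableSet (ell0 E) := by
  -- Convergence to zero with only countable quantifiers, so that measurability is immediate.
  have h2 : ell0 E = ⋂ k : ℕ, ⋃ N : ℕ, ⋂ j : ℤ, {y | N ≤ j.natAbs → ‖y j‖ ≤ (1 / (k + 1) : ℝ)} := by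
    ext y
    simp only [Set.mem_iInter, Set.mem_iUnion, Set.mem_ofPred_eq]
    constructor
    · intro hy k
      have h := (tendsto_zero_iff_norm_tendsto_zero.1
        (show Tendsto y cofinite (𝓝 0) from hy)).eventually_lt_const
          (show (0 : ℝ) < 1 / (k + 1) by positivity)
      rw [eventually_cofinite] at h
      obtain ⟨N, hN⟩ := (h.image Int.natAbs).bddAbove
      refine ⟨N + 1, fun j hj => ?_⟩
      by_contra! hlt
      have := hN ⟨j, not_lt.2 hlt.le, rfl⟩
      omega
    · intro hy
      refine tendsto_zero_iff_norm_tendsto_zero.2 (tendsto_order.2 ⟨fun a ha =>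
        Eventually.of_forall fun j => ha.trans_le (norm_nonneg _), fun a ha => ?_⟩)
      obtain ⟨k, hk⟩ := exists_nat_one_div_lt ha
      obtain ⟨N, hN⟩ := hy k
      rw [eventually_cofinite]
      refine (Set.finite_Icc (-N : ℤ) N).subset fun j hj => ?_
      by_contra hn
      exact hj ((hN j (by simp only [Set.mem_Icc] at hn; omega)).trans_lt hk)
  rw [h2]
  refine .iInter fun k => .iUnion fun N => .iInter fun j => ?_
  by_cases hN : N ≤ j.natAbs
  · simp only [hN, forall_const]
    exact measurableSet_le (by fun_prop) (by fun_prop)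
  · simp [hN]

variable [SecondCountableTopology E]

/-- On `ℓ₀` the map is the pointwise limit of its continuous truncated versions; off `ℓ₀` it is
constant. -/
theorem measurable_toCluster : Measurable (toCluster : (ℤ → E) → ClusterSpace E) := by
  classical
  refine measurable_of_tendsto_metrizable (f := fun (n : ℕ) y =>
    if y ∈ ell0 E then toCluster (trunc (-n) n y) else ClusterSpace.mk 0) (fun n => ?_) ?_
  · exact Measurable.ite measurableSet_ell0 (continuous_toCluster_trunc _ _).measurable
      measurable_const
  · refine tendsto_pi_nhds.2 fun y => ?_
    by_cases hy : y ∈ ell0 E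
    · simpa [hy] using tendsto_toCluster_trunc_nat hy
    · simp [hy, toCluster_of_not_mem hy]

end Measurability

end Truncation

/-! ### Shifts of arbitrary two-sided sequences -/

section SeqShift

variable {E : Type*}

/-- The sequence `B ^ k y`. -/
def seqShift (k : ℤ) (y : ℤ → E) : ℤ → E := fun j => y (j - k)

theorem seqShift_seqShift (k l : ℤ) (y : ℤ → E) :
    seqShift k (seqShift l y) = seqShift (k + l) y := by
  ext j
  simp [seqShift, sub_sub]

theorem seqShift_zero (y : ℤ → E) : seqShift 0 y = y := by
  ext j
  simp [seqShift]

end SeqShift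

/-! ### Test functions and the measures they determine -/

section TestFunctions

variable {E : Type*} [NormedAddCommGroup E]

theorem continuous_seqShift (k : ℤ) : Continuous (seqShift k : (ℤ → E) → ℤ → E) :=
  continuous_pi fun _ => continuous_apply _

/-- A bounded continuous function of the coordinates in `[-n, n]` that vanishes when all of these
have norm at most `ε`. -/
structure IsTest (g : (ℤ → E) → ℝ) (n : ℕ) (ε : ℝ) : Prop where
  continuous : Continuous g
  bounded : ∃ C, ∀ y, |g y| ≤ C
  factor : ∀ y, g (trunc (-n) n y) = g y
  pos : 0 < ε
  zero : ∀ y, (∀ j : ℤ, -n ≤ j → j ≤ n → ‖y j‖ ≤ ε) → g y = 0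

theorem IsTest.comp_seqShift {g : (ℤ → E) → ℝ} {n : ℕ} {ε : ℝ} (hg : IsTest g n ε) (k : ℤ) :
    IsTest (fun y => g (seqShift k y)) (n + k.natAbs) ε where
  continuous := hg.continuous.comp (continuous_seqShift k)
  bounded := hg.bounded.imp fun C hC y => hC _
  factor y := by
    rw [← hg.factor, ← hg.factor (seqShift k y)]
    congr 1
    ext j
    simp only [trunc, seqShift]
    split_ifs <;> first | rfl | omega
  pos := hg.pos
  zero y hy := hg.zero _ fun j h1 h2 => hy _ (by omega) (by omega)

theorem IsTest.comp_smul [NormedSpace ℝ E] {g : (ℤ → E) → ℝ} {n : ℕ} {ε : ℝ} (hg : IsTest g n ε)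
    {c : ℝ} (hc : 0 < c) : IsTest (fun y => g (c • y)) n (c⁻¹ * ε) where
  continuous := hg.continuous.comp (continuous_const_smul c)
  bounded := hg.bounded.imp fun C hC y => hC _
  factor y := by
    rw [← hg.factor, ← hg.factor (c • y)]
    congr 1
    ext j
    simp only [trunc, Pi.smul_apply]
    split_ifs <;> simp
  pos := mul_pos (inv_pos.2 hc) hg.pos
  zero y hy := hg.zero _ fun j h1 h2 => by
    have := hy j h1 h2
    rw [Pi.smul_apply, norm_smul, Real.norm_of_nonneg hc.le]
    rwa [le_inv_mul_iff₀ hc] at this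

/-- A continuous function with values in `[0, 1]` that increases with `N` to the indicator of
the complement of the zero sequence. -/
noncomputable def cutoff (N : ℕ) (y : ℤ → E) : ℝ :=
  min 1 (max 0 (N * (∑ j ∈ Finset.Icc (-N : ℤ) N, ‖y j‖) - 1))

theorem cutoff_nonneg (N : ℕ) (y : ℤ → E) : 0 ≤ cutoff N y :=
  le_min zero_le_one (le_max_left _ _)

theorem cutoff_le_one (N : ℕ) (y : ℤ → E) : cutoff N y ≤ 1 := min_le_left _ _

theorem continuous_cutoff (N : ℕ) : Continuous (cutoff N : (ℤ → E) → ℝ) := by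
  unfold cutoff
  fun_prop

theorem cutoff_mono (y : ℤ → E) : Monotone fun N => cutoff N y := by
  intro M N hMN
  have h : (M : ℝ) ≤ N := by exact_mod_cast hMN
  have h2 : ∑ j ∈ Finset.Icc (-M : ℤ) M, ‖y j‖ ≤ ∑ j ∈ Finset.Icc (-N : ℤ) N, ‖y j‖ :=
    Finset.sum_le_sum_of_subset_of_nonneg (Finset.Icc_subset_Icc (by omega) (by omega))
      fun _ _ _ => norm_nonneg _
  have h3 : 0 ≤ ∑ j ∈ Finset.Icc (-M : ℤ) M, ‖y j‖ := Finset.sum_nonneg fun _ _ => norm_nonneg _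
  exact min_le_min le_rfl (max_le_max le_rfl (sub_le_sub_right
    (mul_le_mul h h2 h3 (Nat.cast_nonneg _)) _))

theorem tendsto_cutoff {y : ℤ → E} (hy : y ≠ 0) : Tendsto (fun N => cutoff N y) atTop (𝓝 1) := by
  obtain ⟨i, hi⟩ := Function.ne_iff.1 hy
  have hi' : 0 < ‖y i‖ := norm_pos_iff.2 hi
  obtain ⟨K, hK⟩ := exists_nat_ge (2 / ‖y i‖)
  refine tendsto_const_nhds.congr' ?_
  filter_upwards [eventually_ge_atTop K, eventually_ge_atTop i.natAbs] with N h1 h2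
  have h3 : ‖y i‖ ≤ ∑ j ∈ Finset.Icc (-N : ℤ) N, ‖y j‖ :=
    Finset.single_le_sum (f := fun j => ‖y j‖) (fun _ _ => norm_nonneg _)
      (Finset.mem_Icc.2 ⟨by omega, by omega⟩)
  have h4 : (K : ℝ) ≤ N := by exact_mod_cast h1
  have h5 : 2 ≤ N * ‖y i‖ := by rw [← div_le_iff₀ hi']; linarith
  have h6 : (N : ℝ) * ‖y i‖ ≤ N * ∑ j ∈ Finset.Icc (-N : ℤ) N, ‖y j‖ := by gcongr
  symm
  exact min_eq_left (le_max_of_le_right (by linarith))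

/-- The window has `2N + 1` coordinates, so the bound makes their sum at most `1 / (N + 1)`;
multiplied by `N` it stays below the threshold `1`. -/
theorem cutoff_eq_zero {N : ℕ} {y : ℤ → E}
    (hy : ∀ j : ℤ, -N ≤ j → j ≤ N → ‖y j‖ ≤ 1 / ((N + 1) * (2 * N + 1))) : cutoff N y = 0 := by
  have h1 : ∑ j ∈ Finset.Icc (-N : ℤ) N, ‖y j‖
      ≤ (Finset.Icc (-N : ℤ) N).card • (1 / (((N : ℝ) + 1) * (2 * N + 1))) :=
    Finset.sum_le_card_nsmul _ _ _ fun j hj => by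
      rw [Finset.mem_Icc] at hj
      exact hy j hj.1 hj.2
  have h2 : (Finset.Icc (-N : ℤ) N).card = 2 * N + 1 := by
    rw [Int.card_Icc]
    omega
  rw [h2, nsmul_eq_mul] at h1
  push_cast at h1
  have h3 : (2 * (N : ℝ) + 1) * (1 / (((N : ℝ) + 1) * (2 * N + 1))) = 1 / (N + 1) := by
    field_simp
  rw [h3] at h1
  have h4 : N * ∑ j ∈ Finset.Icc (-N : ℤ) N, ‖y j‖ ≤ 1 := by
    calc N * ∑ j ∈ Finset.Icc (-N : ℤ) N, ‖y j‖ ≤ N * (1 / ((N : ℝ) + 1)) := by gcongr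
      _ ≤ 1 := by rw [mul_one_div, div_le_one (by positivity)]; linarith
  unfold cutoff
  rw [max_eq_left (by linarith), min_eq_right zero_le_one]

/-- Turns an arbitrary bounded continuous function into a test function, at the price of the cutoff
and a truncation, both of which are removed by limits in `FiniteAwayFromZero.ext`. -/
theorem isTest_cutoff_mul (f : BoundedContinuousFunction (ℤ → E) ℝ) {N n : ℕ} (hn : N ≤ n) :
    IsTest (fun y => cutoff N y * f (trunc (-n) n y)) n (1 / ((N + 1) * (2 * N + 1))) where
  continuous := (continuous_cutoff N).mul (f.continuous.comp (continuous_trunc _ _))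
  bounded := ⟨‖f‖, fun y => by
    rw [abs_mul, abs_of_nonneg (cutoff_nonneg N y)]
    exact (mul_le_of_le_one_left (abs_nonneg _) (cutoff_le_one N y)).trans (f.norm_coe_le_norm _)⟩
  factor y := by
    rw [trunc_trunc _ _ _ _ le_rfl le_rfl]
    congr 1
    unfold cutoff
    congr 4
    refine Finset.sum_congr rfl fun j hj => ?_
    rw [Finset.mem_Icc] at hj
    rw [trunc_apply_of_mem (by omega)]
  pos := by positivity
  zero y hy := by
    rw [cutoff_eq_zero fun j h1 h2 => hy j (by omega) (by omega), zero_mul]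

/-- A measure on sequences without mass at zero, for which every coordinate is bounded away from
zero on a set of finite measure only. -/
structure FiniteAwayFromZero [MeasurableSpace E] (μ : Measure (ℤ → E)) : Prop where
  zero : μ {0} = 0
  finite : ∀ (j : ℤ) (ε : ℝ), 0 < ε → μ {y | ε < ‖y j‖} < ∞

variable [MeasurableSpace E]

theorem FiniteAwayFromZero.finite_window {μ : Measure (ℤ → E)} (hμ : FiniteAwayFromZero μ)
    (n : ℕ) {ε : ℝ} (hε : 0 < ε) :
    μ {y | ¬∀ j : ℤ, -n ≤ j → j ≤ n → ‖y j‖ ≤ ε} < ∞ := by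
  refine lt_of_le_of_lt (measure_mono fun y hy => ?_)
    (measure_biUnion_lt_top (s := Set.Icc (-n : ℤ) n) (f := fun j => {y | ε < ‖y j‖})
      (Set.finite_Icc _ _) fun j _ => hμ.finite j ε hε)
  simp only [Set.mem_ofPred_eq, not_forall, not_le] at hy
  obtain ⟨j, h1, h2, h3⟩ := hy
  exact Set.mem_biUnion (show j ∈ Set.Icc (-n : ℤ) n from ⟨h1, h2⟩) h3

variable [BorelSpace E] [SecondCountableTopology E]

theorem measurableSet_window (n : ℕ) (ε : ℝ) :
    MeasurableSet {y : ℤ → E | ¬∀ j : ℤ, -n ≤ j → j ≤ n → ‖y j‖ ≤ ε} := by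
  have h : IsClosed {y : ℤ → E | ∀ j : ℤ, -n ≤ j → j ≤ n → ‖y j‖ ≤ ε} := by
    simp only [Set.ofPred_forall]
    exact isClosed_iInter fun j => isClosed_iInter fun _ => isClosed_iInter fun _ =>
      isClosed_le (by fun_prop) continuous_const
  exact h.measurableSet.compl

theorem FiniteAwayFromZero.integrable_of_window {μ : Measure (ℤ → E)}
    (hμ : FiniteAwayFromZero μ) {g : (ℤ → E) → ℝ} (hm : AEStronglyMeasurable g μ) {C : ℝ}
    (hC : ∀ y, |g y| ≤ C) {n : ℕ} {ε : ℝ} (hε : 0 < ε)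
    (hz : ∀ y, (∀ j : ℤ, -n ≤ j → j ≤ n → ‖y j‖ ≤ ε) → g y = 0) : Integrable g μ := by
  have hi : Integrable (Set.indicator {y : ℤ → E | ¬∀ j : ℤ, -n ≤ j → j ≤ n → ‖y j‖ ≤ ε}
      fun _ => C) μ :=
    (integrable_indicator_iff (measurableSet_window n ε)).2
      (integrableOn_const (hμ.finite_window n hε).ne)
  refine hi.mono' hm (Eventually.of_forall fun y => ?_)
  by_cases hy : ∀ j : ℤ, -n ≤ j → j ≤ n → ‖y j‖ ≤ ε
  · rw [hz y hy, norm_zero]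
    exact Set.indicator_nonneg (fun _ _ => (abs_nonneg _).trans (hC y)) _
  · exact (hC y).trans_eq (Set.indicator_of_mem
      (s := {y : ℤ → E | ¬∀ j : ℤ, -n ≤ j → j ≤ n → ‖y j‖ ≤ ε}) hy fun _ => C).symm

theorem FiniteAwayFromZero.integrable {μ : Measure (ℤ → E)} (hμ : FiniteAwayFromZero μ)
    {g : (ℤ → E) → ℝ} {n : ℕ} {ε : ℝ} (hg : IsTest g n ε) : Integrable g μ := by
  obtain ⟨C, hC⟩ := hg.bounded
  exact hμ.integrable_of_window hg.continuous.aestronglyMeasurable hC hg.pos hg.zero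

theorem FiniteAwayFromZero.isFiniteMeasure_cutoff {μ : Measure (ℤ → E)}
    (hμ : FiniteAwayFromZero μ) (N : ℕ) :
    IsFiniteMeasure (μ.withDensity fun y => ENNReal.ofReal (cutoff N y)) := by
  refine isFiniteMeasure_withDensity_ofReal ?_
  have h := hμ.integrable (isTest_cutoff_mul (E := E) 1 (le_refl N))
  simp only [BoundedContinuousFunction.coe_one, Pi.one_apply, mul_one] at h
  exact h.2

theorem integral_cutoff_withDensity (μ : Measure (ℤ → E)) (N : ℕ) (f : (ℤ → E) → ℝ) :
    ∫ y, f y ∂(μ.withDensity fun y => ENNReal.ofReal (cutoff N y)) = ∫ y, cutoff N y * f y ∂μ := by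
  rw [integral_withDensity_eq_integral_toReal_smul
    (continuous_cutoff N).measurable.ennreal_ofReal (by simp)]
  simp only [ENNReal.toReal_ofReal (cutoff_nonneg N _), smul_eq_mul]

/-- Measures that are finite away from zero are determined by the integrals of test functions. -/
theorem FiniteAwayFromZero.ext {μ μ' : Measure (ℤ → E)} (hμ : FiniteAwayFromZero μ)
    (hμ' : FiniteAwayFromZero μ')
    (h : ∀ g n ε, IsTest g n ε → ∫ y, g y ∂μ = ∫ y, g y ∂μ') : μ = μ' := by
  have hN : ∀ N : ℕ, μ.withDensity (fun y => ENNReal.ofReal (cutoff N y))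
      = μ'.withDensity fun y => ENNReal.ofReal (cutoff N y) := by
    intro N
    have := hμ.isFiniteMeasure_cutoff N
    have := hμ'.isFiniteMeasure_cutoff N
    refine ext_of_forall_integral_eq_of_IsFiniteMeasure fun f => ?_
    -- A bounded continuous function on the product may depend on all coordinates; truncating its
    -- argument makes it a function of a window, and dominated convergence undoes this.
    have key : ∀ (m : Measure (ℤ → E)) [IsFiniteMeasure m],
        Tendsto (fun n : ℕ => ∫ y, f (trunc (-n) n y) ∂m) atTop (𝓝 (∫ y, f y ∂m)) := by
      intro m _
      refine tendsto_integral_of_dominated_convergence (fun _ => ‖f‖)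
        (fun n => (f.continuous.comp (continuous_trunc _ _)).aestronglyMeasurable)
        (integrable_const _) (fun n => Eventually.of_forall fun y => f.norm_coe_le_norm _)
        (Eventually.of_forall fun y => (f.continuous.tendsto y).comp (tendsto_trunc y))
    refine tendsto_nhds_unique_of_eventuallyEq (key _) (key _) ?_
    filter_upwards [eventually_ge_atTop N] with n hn
    rw [integral_cutoff_withDensity, integral_cutoff_withDensity]
    exact h _ _ _ (isTest_cutoff_mul f hn)
  -- Monotone convergence removes the cutoff; the absence of mass at zero enters here, as every
  -- cutoff vanishes at the zero sequence.
  have lim : ∀ m : Measure (ℤ → E), m {0} = 0 → ∀ A, MeasurableSet A →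
      Tendsto (fun N => m.withDensity (fun y => ENNReal.ofReal (cutoff N y)) A) atTop
        (𝓝 (m A)) := by
    intro m hm A hA
    simp only [withDensity_apply _ hA]
    rw [← setLIntegral_one]
    refine lintegral_tendsto_of_tendsto_of_monotone
      (fun N => (continuous_cutoff N).measurable.ennreal_ofReal.aemeasurable)
      (Eventually.of_forall fun y M N hMN => ENNReal.ofReal_le_ofReal (cutoff_mono y hMN)) ?_
    refine ae_restrict_of_ae ?_
    have h0 : ∀ᵐ y ∂m, y ≠ 0 := by
      rw [ae_iff]
      simpa using hm
    filter_upwards [h0] with y hy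
    rw [← ENNReal.ofReal_one]
    exact ENNReal.tendsto_ofReal (tendsto_cutoff hy)
  refine Measure.ext fun A hA => ?_
  have h1 := lim μ hμ.zero A hA
  simp only [hN] at h1
  exact tendsto_nhds_unique h1 (lim μ' hμ'.zero A hA)

end TestFunctions

/-! ### Extension by zero, ramps at time zero, and tails of `‖X_0‖` -/

section Extension

theorem measurable_restrict_window {E : Type*} [MeasurableSpace E] (s t : ℤ) :
    Measurable fun (y : ℤ → E) (j : Set.Icc s t) => y j :=
  measurable_pi_lambda _ fun _ => measurable_pi_apply _

theorem tail_antitone {Ω : Type*} [MeasurableSpace Ω] {P : Measure Ω}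
    [IsProbabilityMeasure P] {E : Type*} [NormedAddCommGroup E] (X : ℤ → Ω → E) :
    Antitone fun u : ℝ => P.real {ω | u < ‖X 0 ω‖} :=
  fun _ _ huv => measureReal_mono fun _ (hω : _ < _) => huv.trans_lt hω


variable {E : Type*} [NormedAddCommGroup E]

/-- The extension by zero of a vector with coordinates in `[s, t]`. -/
noncomputable def extendZero (s t : ℤ) (x : Set.Icc s t → E) : ℤ → E :=
  fun j => if h : j ∈ Set.Icc s t then x ⟨j, h⟩ else 0

theorem continuous_extendZero (s t : ℤ) :
    Continuous (extendZero s t : (Set.Icc s t → E) → ℤ → E) := by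
  refine continuous_pi fun j => ?_
  by_cases h : j ∈ Set.Icc s t
  · simpa only [extendZero, dif_pos h] using continuous_apply (⟨j, h⟩ : Set.Icc s t)
  · simpa only [extendZero, dif_neg h] using continuous_const

theorem extendZero_restrict (s t : ℤ) (y : ℤ → E) :
    extendZero s t (fun j => y j) = trunc s t y := by
  ext j
  simp only [extendZero, trunc, Set.mem_Icc, dite_eq_ite]

/-- A continuous approximation of the indicator of `a < ‖y 0‖`. -/
noncomputable def ramp (a b : ℝ) (y : ℤ → E) : ℝ := min 1 (max 0 ((‖y 0‖ - a) / (b - a)))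

theorem ramp_nonneg (a b : ℝ) (y : ℤ → E) : 0 ≤ ramp a b y := le_min zero_le_one (le_max_left _ _)

theorem ramp_le_one (a b : ℝ) (y : ℤ → E) : ramp a b y ≤ 1 := min_le_left _ _

theorem ramp_eq_zero {a b : ℝ} (hab : a < b) {y : ℤ → E} (hy : ‖y 0‖ ≤ a) : ramp a b y = 0 := by
  unfold ramp
  rw [max_eq_left (div_nonpos_of_nonpos_of_nonneg (by linarith) (by linarith)),
    min_eq_right zero_le_one]

theorem ramp_eq_one {a b : ℝ} (hab : a < b) {y : ℤ → E} (hy : b ≤ ‖y 0‖) : ramp a b y = 1 :=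
  min_eq_left (le_max_of_le_right ((one_le_div (by linarith)).2 (by linarith)))

theorem continuous_ramp (a b : ℝ) : Continuous (ramp a b : (ℤ → E) → ℝ) := by
  unfold ramp
  fun_prop

/-- The ramp supplies the vanishing near zero, so any bounded continuous function of finitely many
coordinates can be tested once it is localized to `a < ‖y 0‖`. -/
theorem isTest_mul_ramp {a b : ℝ} (ha : 0 < a) (hab : a < b) {g : (ℤ → E) → ℝ} {n : ℕ}
    (hg : Continuous g) (hC : ∃ C, ∀ y, |g y| ≤ C) (hn : ∀ y, g (trunc (-n) n y) = g y) :
    IsTest (fun y => g y * ramp a b y) n a where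
  continuous := hg.mul (continuous_ramp a b)
  bounded := by
    obtain ⟨C, hC⟩ := hC
    refine ⟨C, fun y => ?_⟩
    rw [abs_mul, abs_of_nonneg (ramp_nonneg a b y)]
    exact (mul_le_of_le_one_right (abs_nonneg _) (ramp_le_one a b y)).trans (hC y)
  factor y := by
    unfold ramp
    rw [hn, trunc_apply_of_mem (by omega)]
  pos := ha
  zero y hy := by rw [ramp_eq_zero hab (hy 0 (by omega) (by omega)), mul_zero]

theorem isTest_ramp {a b : ℝ} (ha : 0 < a) (hab : a < b) :
    IsTest (ramp a b : (ℤ → E) → ℝ) 0 a := by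
  simpa using isTest_mul_ramp (E := E) (n := 0) ha hab (g := fun _ => 1) continuous_const
    ⟨1, by simp⟩ (fun _ => rfl)

theorem tendsto_tail_zero {Ω : Type*} [MeasurableSpace Ω] {P : Measure Ω} [IsProbabilityMeasure P]
    {E : Type*} [NormedAddCommGroup E] [MeasurableSpace E] [BorelSpace E] {X : ℤ → Ω → E}
    (hmeas : ∀ j, Measurable (X j)) :
    Tendsto (fun u : ℝ => P.real {ω | u < ‖X 0 ω‖}) atTop (𝓝 0) := by
  have h := tendsto_measure_iInter_atTop (μ := P) (s := fun u : ℝ => {ω | u < ‖X 0 ω‖})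
    (fun u => (measurableSet_lt measurable_const (hmeas 0).norm).nullMeasurableSet)
    (fun u v huv ω (hω : _ < _) => huv.trans_lt hω) ⟨0, measure_ne_top _ _⟩
  have h0 : ⋂ u : ℝ, {ω | u < ‖X 0 ω‖} = ∅ := by
    ext ω
    simp only [Set.mem_iInter, Set.mem_ofPred_eq, Set.mem_empty_iff_false, iff_false, not_forall]
    exact ⟨‖X 0 ω‖, lt_irrefl _⟩
  rw [h0, measure_empty] at h
  exact (ENNReal.tendsto_toReal ENNReal.zero_ne_top).comp h

end Extension

/-! ### First properties of the tail measure and its shift invariance -/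

section TailMeasure

variable {Ω : Type*} [MeasurableSpace Ω] {E : Type*} [NormedAddCommGroup E] [NormedSpace ℝ E]
  [MeasurableSpace E] [BorelSpace E] [SecondCountableTopology E]
  {P : Measure Ω} {X : ℤ → Ω → E} {ν : Measure (ℤ → E)}

theorem IsTailMeasure.finiteAwayFromZero (hν : IsTailMeasure P X ν) : FiniteAwayFromZero ν where
  zero := hν.zero
  finite j ε hε := by
    have h := (hν.proj j j le_rfl).finite ε hε
    have hm : MeasurableSet {x : Set.Icc j j → E | ε < ‖x‖} :=
      measurableSet_lt measurable_const (by fun_prop)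
    rw [Measure.restrict_apply hm, Measure.map_apply (measurable_restrict_window j j)
      (hm.inter (measurableSet_singleton _).compl)] at h
    refine lt_of_le_of_lt (measure_mono fun y (hy : ε < ‖y j‖) => ?_) h
    have h2 : ‖y j‖ ≤ ‖fun i : Set.Icc j j => y i‖ :=
      norm_le_pi_norm (fun i : Set.Icc j j => y i) ⟨j, le_rfl, le_rfl⟩
    refine ⟨hy.trans_le h2, fun h0 => ?_⟩
    rw [Set.mem_singleton_iff] at h0
    simp only at h0
    rw [h0, norm_zero] at h2
    linarith

theorem IsTailMeasure.tendsto_test (hν : IsTailMeasure P X ν) {g : (ℤ → E) → ℝ} {n : ℕ} {ε : ℝ}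
    (hg : IsTest g n ε) :
    Tendsto (fun u : ℝ => (∫ ω, g (fun j => u⁻¹ • X j ω) ∂P) / P.real {ω | u < ‖X 0 ω‖})
      atTop (𝓝 (∫ y, g y ∂ν)) := by
  obtain ⟨C, hC⟩ := hg.bounded
  let f : BoundedContinuousFunction (Set.Icc (-n : ℤ) n → E) ℝ :=
    BoundedContinuousFunction.ofNormedAddCommGroup (fun x => g (extendZero (-n) n x))
      (hg.continuous.comp (continuous_extendZero _ _)) C fun x => hC _
  have hf : ∀ y : ℤ → E, f (fun j => y j) = g y := fun y => by
    change g (extendZero _ _ _) = _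
    rw [extendZero_restrict, hg.factor]
  have hz : ∀ x, ‖x‖ ≤ ε → f x = 0 := by
    intro x hx
    refine hg.zero _ fun j h1 h2 => ?_
    simp only [extendZero, dif_pos (show j ∈ Set.Icc (-n : ℤ) n from ⟨h1, h2⟩)]
    exact (norm_le_pi_norm x _).trans hx
  have h := (hν.proj (-n) n (by omega)).tendsto f ⟨ε, hg.pos, hz⟩
  -- Removing the origin from the projected measure costs nothing because `f` vanishes there. The
  -- projection may have an atom at the origin, even an infinite one.
  have hi : ∫ x, f x ∂((ν.map fun y (j : Set.Icc (-n : ℤ) n) => y j).restrict {0}ᶜ)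
      = ∫ y, g y ∂ν := by
    rw [setIntegral_eq_integral_of_forall_compl_eq_zero, integral_map
      (measurable_restrict_window _ _).aemeasurable f.continuous.aestronglyMeasurable]
    · simp only [hf]
    · intro x hx
      rw [Set.mem_compl_iff, not_not, Set.mem_singleton_iff] at hx
      exact hz x (by rw [hx, norm_zero]; exact hg.pos.le)
  rw [hi] at h
  refine h.congr fun u => ?_
  congr 1
  exact integral_congr_ae (Eventually.of_forall fun ω => hf fun j => u⁻¹ • X j ω)

/-- If all these integrals were at most zero, `ν` would not charge `{y 0 ≠ 0}`, and the limit
measure of the single coordinate `X_0` would be zero. This positive integral is what later gets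
divided by. -/
theorem IsTailMeasure.exists_integral_ramp_pos (hν : IsTailMeasure P X ν) :
    ∃ a : ℝ, 0 < a ∧ 0 < ∫ y, ramp a (2 * a) y ∂ν := by
  have hne := (hν.proj 0 0 le_rfl).ne_zero
  by_contra! hcon
  refine hne ?_
  rw [← Measure.measure_univ_eq_zero, Measure.restrict_apply .univ, Set.univ_inter,
    Measure.map_apply (measurable_restrict_window 0 0) (measurableSet_singleton _).compl]
  have hsub : (fun (y : ℤ → E) (j : Set.Icc (0 : ℤ) 0) => y j) ⁻¹' {0}ᶜ
      ⊆ ⋃ k : ℕ, {y | 2 * (1 / ((k : ℝ) + 1)) < ‖y 0‖} := by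
    intro y hy
    have h0 : y 0 ≠ 0 := by
      intro h
      refine hy ?_
      ext ⟨j, hj⟩
      obtain rfl : j = 0 := le_antisymm hj.2 hj.1
      exact h
    obtain ⟨k, hk⟩ := exists_nat_one_div_lt (half_pos (norm_pos_iff.2 h0))
    refine Set.mem_iUnion.2 ⟨k, ?_⟩
    rw [Set.mem_ofPred_eq]
    linarith
  refine measure_mono_null hsub (measure_iUnion_null fun k => ?_)
  have ha : (0 : ℝ) < 1 / ((k : ℝ) + 1) := by positivity
  set a : ℝ := 1 / ((k : ℝ) + 1)
  have hi := hν.finiteAwayFromZero.integrable (isTest_ramp (E := E) ha (by linarith : a < 2 * a))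
  have h0 := (integral_eq_zero_iff_of_nonneg (ramp_nonneg a (2 * a)) hi).1
    (le_antisymm (hcon a ha) (integral_nonneg (ramp_nonneg a (2 * a))))
  refine measure_mono_null (fun y (hy : 2 * a < ‖y 0‖) => ?_) (ae_iff.1 h0)
  rw [Set.mem_ofPred_eq, ramp_eq_one (by linarith) hy.le]
  exact one_ne_zero

theorem IsTailMeasure.map_seqShift (hν : IsTailMeasure P X ν) (hmeas : ∀ j, Measurable (X j))
    (hstat : IsStationary P X) (k : ℤ) : ν.map (seqShift k) = ν := by
  have hms : ∀ k : ℤ, Measurable (seqShift k : (ℤ → E) → ℤ → E) := fun k =>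
    (continuous_seqShift k).measurable
  -- `seqShift (-1)` sends `y` to `j ↦ y (j + 1)`, which is the shift in the definition of
  -- stationarity; the two sides are limits of the same ratios.
  have h1 : ν.map (seqShift (-1)) = ν := by
    refine FiniteAwayFromZero.ext ⟨?_, fun j ε hε => ?_⟩ hν.finiteAwayFromZero
      fun g n ε hg => ?_
    · rw [Measure.map_apply (hms _) (measurableSet_singleton _)]
      refine measure_mono_null (fun y hy => ?_) hν.zero
      have h0 : seqShift (-1) y = 0 := hy
      have := congrArg (seqShift 1) h0
      rw [seqShift_seqShift, add_neg_cancel, seqShift_zero] at this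
      exact this
    · rw [Measure.map_apply (hms _) (measurableSet_lt measurable_const (by fun_prop))]
      exact hν.finiteAwayFromZero.finite _ ε hε
    · rw [integral_map (hms _).aemeasurable hg.continuous.aestronglyMeasurable]
      refine tendsto_nhds_unique ((hν.tendsto_test (hg.comp_seqShift (-1))).congr fun u => ?_)
        (hν.tendsto_test hg)
      congr 1
      have hX : ∀ k : ℤ, Measurable fun ω (j : ℤ) => X (j + k) ω := fun k =>
        measurable_pi_lambda _ fun j => hmeas _
      have hG : Continuous fun y : ℤ → E => g (u⁻¹ • y) :=
        hg.continuous.comp (continuous_const_smul _)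
      have e := integral_map (μ := P) (hX 1).aemeasurable
        (f := fun y => g (u⁻¹ • y)) hG.aestronglyMeasurable
      have e' := integral_map (μ := P) (hX 0).aemeasurable
        (f := fun y => g (u⁻¹ • y)) hG.aestronglyMeasurable
      simp only [add_zero] at e'
      rw [hstat, e'] at e
      refine Eq.trans ?_ e.symm
      refine integral_congr_ae (Eventually.of_forall fun ω => ?_)
      change g _ = g _
      congr 1
  have hcomp : ∀ k l : ℤ, (ν.map (seqShift l)).map (seqShift k) = ν.map (seqShift (k + l)) := by
    intro k l
    rw [Measure.map_map (hms k) (hms l)]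
    congr 1
    ext1 y
    exact seqShift_seqShift k l y
  have h0 : ν.map (seqShift 0) = ν := by
    have : (seqShift 0 : (ℤ → E) → ℤ → E) = id := funext seqShift_zero
    rw [this, Measure.map_id]
  have h2 : ν.map (seqShift 1) = ν := by
    have := hcomp 1 (-1)
    rwa [h1, add_neg_cancel, h0] at this
  induction k with
  | zero => exact h0
  | succ i hi => rw [add_comm, ← hcomp, hi, h2]
  | pred i hi => rw [sub_eq_add_neg, add_comm, ← hcomp, hi, h1]

variable [IsProbabilityMeasure P]

/-- A ratio with denominator zero is zero by convention, which is incompatible with a positive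
limit; so the tail is positive at arbitrarily high levels, hence at all by monotonicity. -/
theorem IsTailMeasure.tail_pos (hν : IsTailMeasure P X ν) (u : ℝ) :
    0 < P.real {ω | u < ‖X 0 ω‖} := by
  obtain ⟨a, ha, hpos⟩ := hν.exists_integral_ramp_pos
  have h := hν.tendsto_test (isTest_ramp (E := E) ha (by linarith : a < 2 * a))
  obtain ⟨v, hv, huv⟩ := ((h.eventually_const_lt hpos).and (eventually_ge_atTop u)).exists
  refine lt_of_lt_of_le (lt_of_le_of_ne measureReal_nonneg fun h0 => ?_) (tail_antitone X huv)
  rw [← h0, div_zero] at hv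
  exact lt_irrefl _ hv

end TailMeasure

/-! ### The index of regular variation and homogeneity -/

section Index

/-- A positive, antitone, multiplicative function on `(0, ∞)` is a power. -/
theorem eq_rpow_of_multiplicative {h : ℝ → ℝ} (hpos : ∀ x, 0 < x → 0 < h x)
    (hanti : ∀ x y, 0 < x → x ≤ y → h y ≤ h x)
    (hmul : ∀ x y, 0 < x → 0 < y → h (x * y) = h x * h y) :
    ∃ α : ℝ, 0 ≤ α ∧ ∀ x, 0 < x → h x = x ^ (-α) := by
  have h1 : h 1 = 1 := by
    have := hmul 1 1 one_pos one_pos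
    rw [mul_one] at this
    exact (mul_eq_left₀ (hpos 1 one_pos).ne').1 this.symm
  -- In logarithmic coordinates the function is additive and antitone, hence measurable, hence
  -- continuous, hence linear.
  let φ : ℝ →+ ℝ :=
    { toFun := fun t => Real.log (h (Real.exp t))
      map_zero' := by simp [h1]
      map_add' := fun s t => by
        rw [Real.exp_add, hmul _ _ (Real.exp_pos _) (Real.exp_pos _),
          Real.log_mul (hpos _ (Real.exp_pos _)).ne' (hpos _ (Real.exp_pos _)).ne'] }
  have hφ : Antitone φ := fun s t hst => Real.log_le_log (hpos _ (Real.exp_pos _))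
    (hanti _ _ (Real.exp_pos _) (Real.exp_le_exp.2 hst))
  have hc : Continuous φ :=
    MeasureTheory.Measure.AddMonoidHom.continuous_of_measurable φ hφ.measurable
  refine ⟨-φ 1, ?_, fun x hx => ?_⟩
  · have := hφ (zero_le_one' ℝ)
    rw [map_zero] at this
    linarith
  · have h2 : φ (Real.log x) = Real.log x * φ 1 := by
      have := (φ.toRealLinearMap hc).map_smul (Real.log x) 1
      simpa using this
    have h3 : φ (Real.log x) = Real.log (h x) := by
      change Real.log (h (Real.exp (Real.log x))) = _
      rw [Real.exp_log hx]
    rw [neg_neg, Real.rpow_def_of_pos hx, ← h2, h3, Real.exp_log (hpos x hx)]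

variable {Ω : Type*} [MeasurableSpace Ω] {E : Type*} [NormedAddCommGroup E] [NormedSpace ℝ E]
  [MeasurableSpace E] [BorelSpace E] [SecondCountableTopology E]
  {P : Measure Ω} {X : ℤ → Ω → E} {ν : Measure (ℤ → E)}

/-- Serves to exclude index zero. Shrinking by `2 ^ n ≥ 1` keeps the integrand below the indicator
of `a < ‖y 0‖`, which has finite mass. -/
theorem tendsto_integral_ramp_zero (hν : FiniteAwayFromZero ν) {a : ℝ} (ha : 0 < a) :
    Tendsto (fun n : ℕ => ∫ y, ramp a (2 * a) (((2 : ℝ) ^ n)⁻¹ • y) ∂ν) atTop (𝓝 0) := by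
  have hlt : a < 2 * a := by linarith
  have h := tendsto_integral_of_dominated_convergence (μ := ν) (f := fun _ => 0)
    (F := fun (n : ℕ) y => ramp a (2 * a) (((2 : ℝ) ^ n)⁻¹ • y))
    (Set.indicator {y | a < ‖y 0‖} fun _ => 1)
    (fun n => ((continuous_ramp _ _).comp (continuous_const_smul _)).aestronglyMeasurable)
    ((integrable_indicator_iff (measurableSet_lt measurable_const (by fun_prop))).2
      (integrableOn_const (hν.finite 0 a ha).ne))
    (fun n => Eventually.of_forall fun y => ?_) (Eventually.of_forall fun y => ?_)
  · simpa using h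
  · rw [Real.norm_of_nonneg (ramp_nonneg _ _ _)]
    by_cases hy : a < ‖y 0‖
    · rw [Set.indicator_of_mem (show y ∈ {y : ℤ → E | a < ‖y 0‖} from hy)]
      exact ramp_le_one _ _ _
    · rw [ramp_eq_zero hlt]
      · exact Set.indicator_nonneg (fun _ _ => zero_le_one) _
      · rw [Pi.smul_apply, norm_smul, norm_inv, norm_pow, Real.norm_ofNat]
        refine (mul_le_of_le_one_left (norm_nonneg _) ?_).trans (not_lt.1 hy)
        exact inv_le_one_of_one_le₀ (one_le_pow₀ one_le_two)
  · have h1 : Tendsto (fun n : ℕ => ((2 : ℝ) ^ n)⁻¹ * ‖y 0‖) atTop (𝓝 0) := by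
      simpa using (tendsto_inv_atTop_zero.comp
        (tendsto_pow_atTop_atTop_of_one_lt one_lt_two)).mul_const ‖y 0‖
    refine tendsto_const_nhds.congr' ?_
    filter_upwards [h1.eventually_lt_const ha] with n hn
    rw [ramp_eq_zero hlt]
    rw [Pi.smul_apply, norm_smul, norm_inv, norm_pow, Real.norm_ofNat]
    exact hn.le

/-- The two limits that link the tail of `‖X 0‖` and the integrals of rescaled test functions. -/
theorem IsTailMeasure.tendsto_test_mul (hν : IsTailMeasure P X ν) {g : (ℤ → E) → ℝ} {n : ℕ}
    {ε : ℝ} (hg : IsTest g n ε) {c : ℝ} (hc : 0 < c) :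
    Tendsto (fun u : ℝ => (∫ ω, g (fun j => (c * u)⁻¹ • X j ω) ∂P) /
        P.real {ω | u < ‖X 0 ω‖}) atTop (𝓝 (∫ y, g (c⁻¹ • y) ∂ν)) ∧
      Tendsto (fun u : ℝ => (∫ ω, g (fun j => (c * u)⁻¹ • X j ω) ∂P) /
        P.real {ω | c * u < ‖X 0 ω‖}) atTop (𝓝 (∫ y, g y ∂ν)) := by
  constructor
  · refine (hν.tendsto_test (hg.comp_smul (inv_pos.2 hc))).congr fun u => ?_
    congr 2
    ext ω
    congr 1
    ext j
    rw [Pi.smul_apply, smul_smul, mul_inv]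
  · exact (hν.tendsto_test hg).comp (tendsto_id.const_mul_atTop hc)

variable [IsProbabilityMeasure P]

/-- The tail of `‖X 0‖` is regularly varying with some index `α > 0`. -/
theorem IsTailMeasure.exists_index (hν : IsTailMeasure P X ν) :
    ∃ α : ℝ, 0 < α ∧ ∀ c : ℝ, 0 < c →
      Tendsto (fun u : ℝ => P.real {ω | c * u < ‖X 0 ω‖} / P.real {ω | u < ‖X 0 ω‖}) atTop
        (𝓝 (c ^ (-α))) := by
  obtain ⟨a, ha, hpos⟩ := hν.exists_integral_ramp_pos
  have hg := isTest_ramp (E := E) ha (by linarith : a < 2 * a)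
  set I := ∫ y, ramp a (2 * a) y ∂ν
  -- The two limits of `IsTailMeasure.tendsto_test_mul` share their numerator, so their quotient is
  -- the limit of the ratio of tails.
  let h : ℝ → ℝ := fun c => (∫ y, ramp a (2 * a) (c⁻¹ • y) ∂ν) / I
  have hlim : ∀ c : ℝ, 0 < c →
      Tendsto (fun u : ℝ => P.real {ω | c * u < ‖X 0 ω‖} / P.real {ω | u < ‖X 0 ω‖}) atTop
        (𝓝 (h c)) := by
    intro c hc
    obtain ⟨h1, h2⟩ := hν.tendsto_test_mul hg hc
    refine (h1.div h2 hpos.ne').congr' ?_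
    filter_upwards [h2.eventually_const_lt hpos] with u hu
    have hV' := (hν.tail_pos (c * u)).ne'
    have hI : ∫ ω, ramp a (2 * a) (fun j => (c * u)⁻¹ • X j ω) ∂P ≠ 0 := by
      intro h0
      rw [h0, zero_div] at hu
      exact lt_irrefl _ hu
    rw [Pi.div_apply, div_div_div_cancel_left' _ _ hI]
  have hnonneg : ∀ c, 0 < c → 0 ≤ h c := fun c hc =>
    ge_of_tendsto' (hlim c hc) fun u => by positivity
  have hmul : ∀ x y, 0 < x → 0 < y → h (x * y) = h x * h y := by
    intro x y hx hy
    refine tendsto_nhds_unique (hlim _ (mul_pos hx hy)) ?_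
    refine (((hlim x hx).comp (tendsto_id.const_mul_atTop hy)).mul (hlim y hy)).congr fun u => ?_
    simp only [Function.comp, id]
    rw [div_mul_div_cancel₀ (hν.tail_pos _).ne', mul_assoc]
  have h1 : h 1 = 1 := by
    refine tendsto_nhds_unique (hlim 1 one_pos) (tendsto_const_nhds.congr fun u => ?_)
    rw [one_mul, div_self (hν.tail_pos u).ne']
  have hpos' : ∀ c, 0 < c → 0 < h c := by
    intro c hc
    refine lt_of_le_of_ne (hnonneg c hc) fun h0 => ?_
    have := hmul c c⁻¹ hc (inv_pos.2 hc)
    rw [mul_inv_cancel₀ hc.ne', h1, ← h0, zero_mul] at this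
    exact one_ne_zero this
  have hanti : ∀ x y, 0 < x → x ≤ y → h y ≤ h x := by
    intro x y hx hxy
    refine le_of_tendsto_of_tendsto (hlim y (hx.trans_le hxy)) (hlim x hx) ?_
    filter_upwards [eventually_ge_atTop 0] with u hu
    gcongr ?_ / _
    exact tail_antitone X (mul_le_mul_of_nonneg_right hxy hu)
  obtain ⟨α, hα, hα'⟩ := eq_rpow_of_multiplicative hpos' hanti hmul
  -- With `α = 0` the integrals of the rescaled ramp would all equal `I > 0`, although they tend to
  -- zero along the scales `2 ^ n`.
  refine ⟨α, lt_of_le_of_ne hα fun h0 => ?_, fun c hc => hα' c hc ▸ hlim c hc⟩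
  have hz := tendsto_integral_ramp_zero hν.finiteAwayFromZero ha
  have hI : ∀ n : ℕ, ∫ y, ramp a (2 * a) (((2 : ℝ) ^ n)⁻¹ • y) ∂ν = I := by
    intro n
    have := hα' (2 ^ n) (by positivity)
    rw [← h0, neg_zero, Real.rpow_zero] at this
    exact (div_eq_one_iff_eq hpos.ne').1 this
  simp only [hI] at hz
  exact hpos.ne' (tendsto_nhds_unique tendsto_const_nhds hz)

/-- Homogeneity of the tail measure. -/
theorem IsTailMeasure.map_smul (hν : IsTailMeasure P X ν) {α : ℝ}
    (hα : ∀ c : ℝ, 0 < c →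
      Tendsto (fun u : ℝ => P.real {ω | c * u < ‖X 0 ω‖} / P.real {ω | u < ‖X 0 ω‖}) atTop
        (𝓝 (c ^ (-α)))) {c : ℝ} (hc : 0 < c) :
    ν.map (fun y => c • y) = ENNReal.ofReal (c ^ α) • ν := by
  have hf := hν.finiteAwayFromZero
  have hm : Measurable fun y : ℤ → E => c • y := (continuous_const_smul c).measurable
  refine FiniteAwayFromZero.ext ⟨?_, fun j ε hε => ?_⟩ ⟨?_, fun j ε hε => ?_⟩ fun g n ε hg => ?_
  · rw [Measure.map_apply hm (measurableSet_singleton _)]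
    refine measure_mono_null (fun y hy => ?_) hν.zero
    exact (smul_eq_zero.1 (show c • y = 0 from hy)).resolve_left hc.ne'
  · rw [Measure.map_apply hm (measurableSet_lt measurable_const (by fun_prop))]
    refine lt_of_le_of_lt (measure_mono fun y (hy : ε < ‖(c • y) j‖) => ?_)
      (hf.finite j (c⁻¹ * ε) (mul_pos (inv_pos.2 hc) hε))
    rw [Pi.smul_apply, norm_smul, Real.norm_of_nonneg hc.le] at hy
    rwa [Set.mem_ofPred_eq, inv_mul_lt_iff₀ hc]
  · rw [Measure.smul_apply, hν.zero, smul_zero]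
  · rw [Measure.smul_apply, smul_eq_mul]
    exact ENNReal.mul_lt_top ENNReal.ofReal_lt_top (hf.finite j ε hε)
  · rw [integral_map hm.aemeasurable hg.continuous.aestronglyMeasurable, integral_smul_measure,
      ENNReal.toReal_ofReal (by positivity), smul_eq_mul]
    -- The scale is `c⁻¹`: one normalization gives the integral of `g (c • y)`, the other that of
    -- `g`, and the tails differ by the factor `(c⁻¹) ^ (-α) = c ^ α`.
    obtain ⟨h1, h2⟩ := hν.tendsto_test_mul hg (inv_pos.2 hc)
    rw [inv_inv] at h1
    refine tendsto_nhds_unique h1 ?_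
    have h3 := (hα c⁻¹ (inv_pos.2 hc)).mul h2
    rw [Real.inv_rpow hc.le, Real.rpow_neg hc.le, inv_inv] at h3
    refine h3.congr fun u => ?_
    have hV := (hν.tail_pos (c⁻¹ * u)).ne'
    rw [div_mul_div_comm, mul_comm, mul_div_mul_right _ _ hV]

/-- The mass of the exceedances at time zero. -/
theorem IsTailMeasure.measure_lt_norm (hν : IsTailMeasure P X ν) (hmeas : ∀ j, Measurable (X j))
    {α : ℝ}
    (hα : ∀ c : ℝ, 0 < c →
      Tendsto (fun u : ℝ => P.real {ω | c * u < ‖X 0 ω‖} / P.real {ω | u < ‖X 0 ω‖}) atTop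
        (𝓝 (c ^ (-α)))) {t : ℝ} (ht : 0 < t) :
    ν {y | t < ‖y 0‖} = ENNReal.ofReal (t ^ (-α)) := by
  have hf := hν.finiteAwayFromZero
  have hms : ∀ t : ℝ, MeasurableSet {y : ℤ → E | t < ‖y 0‖} := fun t =>
    measurableSet_lt measurable_const (by fun_prop)
  have hmX : ∀ t : ℝ, MeasurableSet {ω | t < ‖X 0 ω‖} := fun t =>
    measurableSet_lt measurable_const (hmeas 0).norm
  -- comparison of the integral of the ramp with the tails
  have hramp : ∀ a b : ℝ, 0 < a → a < b →
      ∫ y, ramp a b y ∂ν ≤ a ^ (-α) ∧ b ^ (-α) ≤ ∫ y, ramp a b y ∂ν := by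
    intro a b ha hab
    have hXm : ∀ u : ℝ, Measurable fun ω (j : ℤ) => u⁻¹ • X j ω := fun u =>
      measurable_pi_lambda _ fun j => (hmeas j).const_smul _
    have hint : ∀ u : ℝ, Integrable (fun ω => ramp a b (fun j => u⁻¹ • X j ω)) P := fun u =>
      Integrable.of_bound
        ((continuous_ramp a b).measurable.comp (hXm u)).aestronglyMeasurable 1
        (Eventually.of_forall fun ω => by
          rw [Real.norm_of_nonneg (ramp_nonneg _ _ _)]
          exact ramp_le_one _ _ _)
    have hind : ∀ t : ℝ, ∫ ω, Set.indicator {ω | t < ‖X 0 ω‖} (fun _ => (1 : ℝ)) ω ∂P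
        = P.real {ω | t < ‖X 0 ω‖} := fun t => by
      rw [integral_indicator (hmX t), setIntegral_const, smul_eq_mul, mul_one]
    have hindi : ∀ t : ℝ, Integrable (Set.indicator {ω | t < ‖X 0 ω‖} fun _ => (1 : ℝ)) P :=
      fun t => (integrable_const _).indicator (hmX t)
    have hlim := hν.tendsto_test (isTest_ramp (E := E) ha hab)
    constructor
    · refine le_of_tendsto_of_tendsto hlim (hα a ha) ?_
      filter_upwards [eventually_gt_atTop 0] with u hu
      gcongr ?_ / _
      rw [← hind]
      refine integral_mono (hint u) (hindi _) fun ω => ?_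
      by_cases hω : a * u < ‖X 0 ω‖
      · simp only
        rw [Set.indicator_of_mem (show ω ∈ {ω | a * u < ‖X 0 ω‖} from hω)]
        exact ramp_le_one _ _ _
      · simp only
        rw [ramp_eq_zero hab]
        · exact Set.indicator_nonneg (fun _ _ => zero_le_one) _
        · rw [norm_smul, norm_inv, Real.norm_of_nonneg hu.le, inv_mul_le_iff₀ hu, mul_comm]
          exact not_lt.1 hω
    · refine le_of_tendsto_of_tendsto (hα b (ha.trans hab)) hlim ?_
      filter_upwards [eventually_gt_atTop 0] with u hu
      gcongr ?_ / _
      rw [← hind]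
      refine integral_mono (hindi _) (hint u) fun ω => ?_
      by_cases hω : b * u < ‖X 0 ω‖
      · simp only
        rw [Set.indicator_of_mem (show ω ∈ {ω | b * u < ‖X 0 ω‖} from hω), ramp_eq_one hab]
        rw [norm_smul, norm_inv, Real.norm_of_nonneg hu.le, le_inv_mul_iff₀ hu, mul_comm]
        exact hω.le
      · simp only
        rw [Set.indicator_of_notMem (show ω ∉ {ω | b * u < ‖X 0 ω‖} from hω)]
        exact ramp_nonneg _ _ _
  -- comparison of the integral of the ramp with the masses
  have hmass : ∀ a b : ℝ, 0 < a → a < b →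
      ∫ y, ramp a b y ∂ν ≤ ν.real {y | a < ‖y 0‖} ∧
        ν.real {y | b < ‖y 0‖} ≤ ∫ y, ramp a b y ∂ν := by
    intro a b ha hab
    have hind : ∀ t : ℝ, ∫ y, Set.indicator {y : ℤ → E | t < ‖y 0‖} (fun _ => (1 : ℝ)) y ∂ν
        = ν.real {y | t < ‖y 0‖} := fun t => by
      rw [integral_indicator (hms t), setIntegral_const, smul_eq_mul, mul_one]
    have hindi : ∀ t : ℝ, 0 < t →
        Integrable (Set.indicator {y : ℤ → E | t < ‖y 0‖} fun _ => (1 : ℝ)) ν := fun t ht =>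
      (integrable_indicator_iff (hms t)).2 (integrableOn_const (hf.finite 0 t ht).ne)
    have hint := hf.integrable (isTest_ramp (E := E) ha hab)
    constructor
    · rw [← hind]
      refine integral_mono hint (hindi _ ha) fun y => ?_
      by_cases hy : a < ‖y 0‖
      · rw [Set.indicator_of_mem (show y ∈ {y : ℤ → E | a < ‖y 0‖} from hy)]
        exact ramp_le_one _ _ _
      · rw [ramp_eq_zero hab (not_lt.1 hy)]
        exact Set.indicator_nonneg (fun _ _ => zero_le_one) _
    · rw [← hind]
      refine integral_mono (hindi _ (ha.trans hab)) hint fun y => ?_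
      by_cases hy : b < ‖y 0‖
      · rw [Set.indicator_of_mem (show y ∈ {y : ℤ → E | b < ‖y 0‖} from hy),
          ramp_eq_one hab hy.le]
      · rw [Set.indicator_of_notMem (show y ∉ {y : ℤ → E | b < ‖y 0‖} from hy)]
        exact ramp_nonneg _ _ _
  -- Ramps ending at `t` bound the mass from above and ramps starting at `t` bound it from below;
  -- continuity of the power closes the gap, so the sphere `‖y 0‖ = t` needs no separate treatment.
  have hcont : Tendsto (fun b : ℝ => b ^ (-α)) (𝓝 t) (𝓝 (t ^ (-α))) :=
    (Real.continuousAt_rpow_const _ _ (Or.inl ht.ne')).tendsto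
  have hreal : ν.real {y | t < ‖y 0‖} = t ^ (-α) := by
    refine le_antisymm ?_ ?_
    · refine ge_of_tendsto (hcont.mono_left (nhdsWithin_le_nhds (s := Set.Iio t))) ?_
      filter_upwards [Ioo_mem_nhdsLT ht] with a ha
      exact (hmass a t ha.1 ha.2).2.trans (hramp a t ha.1 ha.2).1
    · refine le_of_tendsto (hcont.mono_left (nhdsWithin_le_nhds (s := Set.Ioi t))) ?_
      filter_upwards [self_mem_nhdsWithin] with b hb
      exact (hramp t b ht hb).2.trans (hmass t b ht hb).1
  rw [← hreal, measureReal_def, ENNReal.ofReal_toReal (hf.finite 0 t ht).ne]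

end Index

/-! ### The tail process as a restriction of the tail measure -/

section TailProcessLaw

variable {Ω : Type*} [MeasurableSpace Ω] {E : Type*} [NormedAddCommGroup E]
  [MeasurableSpace E] [BorelSpace E]

theorem measurableSet_lt_norm_zero (t : ℝ) : MeasurableSet {y : ℤ → E | t < ‖y 0‖} :=
  measurableSet_lt measurable_const (by fun_prop)

variable [SecondCountableTopology E]

/-- The two integrands agree off the shell `1 < ‖y 0‖ ≤ b`, where they differ by at most `C`. The
measure is left general because the bound is needed for the law of `X / u` as well as for `ν`. -/
theorem abs_setIntegral_sub_integral_mul_ramp_le {m : Measure (ℤ → E)} {g : (ℤ → E) → ℝ}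
    (hg : Continuous g) {C : ℝ} (hC : ∀ y, |g y| ≤ C) {b : ℝ} (hb : 1 < b)
    (hm : m {y | 1 < ‖y 0‖} < ∞) :
    |∫ y in {y | 1 < ‖y 0‖}, g y ∂m - ∫ y, g y * ramp 1 b y ∂m|
      ≤ C * (m.real {y | 1 < ‖y 0‖} - m.real {y | b < ‖y 0‖}) := by
  have hC0 : 0 ≤ C := (abs_nonneg _).trans (hC 0)
  set A : Set (ℤ → E) := {y | 1 < ‖y 0‖} with hA
  set B : Set (ℤ → E) := {y | b < ‖y 0‖} with hB
  have hBm : MeasurableSet B := measurableSet_lt_norm_zero b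
  have hBA : B ⊆ A := fun y (hy : b < ‖y 0‖) => hb.trans hy
  have hr : ∀ y ∉ A, ramp 1 b y = 0 := fun y hy => ramp_eq_zero hb (not_lt.1 hy)
  have hiA : IntegrableOn (fun _ => (1 : ℝ)) A m := integrableOn_const hm.ne
  have hi1 : IntegrableOn g A m :=
    (hiA.const_mul C).mono' hg.aestronglyMeasurable.restrict (Eventually.of_forall fun y => by
      rw [mul_one]
      exact hC y)
  have hi2 : IntegrableOn (fun y => g y * ramp 1 b y) A m :=
    hi1.norm.mono' (hg.mul (continuous_ramp 1 b)).aestronglyMeasurable.restrict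
      (Eventually.of_forall fun y => by
        rw [norm_mul, Real.norm_of_nonneg (ramp_nonneg 1 b y)]
        exact mul_le_of_le_one_right (norm_nonneg _) (ramp_le_one 1 b y))
  have hiB : IntegrableOn (B.indicator fun _ => (1 : ℝ)) A m := hiA.indicator hBm
  have e2 : ∫ y, g y * ramp 1 b y ∂m = ∫ y in A, g y * ramp 1 b y ∂m :=
    (setIntegral_eq_integral_of_forall_compl_eq_zero fun y hy => by rw [hr y hy, mul_zero]).symm
  have e3 : m.real A - m.real B = ∫ y in A, (1 - B.indicator (fun _ => (1 : ℝ)) y) ∂m := by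
    have h1 : ∫ _ in A, (1 : ℝ) ∂m = m.real A := by
      rw [setIntegral_const, smul_eq_mul, mul_one]
    have h2 : ∫ y in A, B.indicator (fun _ => (1 : ℝ)) y ∂m = m.real B := by
      rw [integral_indicator hBm, Measure.restrict_restrict hBm, Set.inter_eq_left.2 hBA,
        setIntegral_const, smul_eq_mul, mul_one]
    rw [integral_sub hiA hiB, h1, h2]
  rw [e2, ← integral_sub hi1 hi2, e3, ← integral_const_mul]
  rw [← Real.norm_eq_abs]
  refine norm_integral_le_of_norm_le (Integrable.const_mul (hiA.sub hiB) C)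
    (Eventually.of_forall fun y => ?_)
  rw [Real.norm_eq_abs, ← mul_one_sub, abs_mul,
    abs_of_nonneg (sub_nonneg.2 (ramp_le_one 1 b y))]
  refine mul_le_mul (hC y) ?_ (sub_nonneg.2 (ramp_le_one 1 b y)) hC0
  refine sub_le_sub_left ?_ 1
  by_cases hy : y ∈ B
  · rw [Set.indicator_of_mem hy, ramp_eq_one hb (le_of_lt hy)]
  · rw [Set.indicator_of_notMem hy]
    exact ramp_nonneg _ _ _

variable [NormedSpace ℝ E] {P : Measure Ω} [IsProbabilityMeasure P]
  {X : ℤ → Ω → E} {ν : Measure (ℤ → E)}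

/-- The indicator of `1 < ‖y 0‖` is not continuous, so it is replaced by a ramp on `[1, b]`. The
error before and in the limit is governed by a shell whose normalized mass tends to `1 - b ^ (-α)`,
small for `b` near `1`. -/
theorem IsTailMeasure.tendsto_setIntegral (hν : IsTailMeasure P X ν)
    (hmeas : ∀ j, Measurable (X j)) {α : ℝ}
    (hα : ∀ c : ℝ, 0 < c →
      Tendsto (fun u : ℝ => P.real {ω | c * u < ‖X 0 ω‖} / P.real {ω | u < ‖X 0 ω‖}) atTop
        (𝓝 (c ^ (-α)))) {g : (ℤ → E) → ℝ} {n : ℕ} (hg : Continuous g) {C : ℝ}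
    (hC : ∀ y, |g y| ≤ C) (hn : ∀ y, g (trunc (-n) n y) = g y) :
    Tendsto (fun u : ℝ => (∫ ω in {ω | u < ‖X 0 ω‖}, g (fun j => u⁻¹ • X j ω) ∂P) /
        P.real {ω | u < ‖X 0 ω‖}) atTop (𝓝 (∫ y in {y | 1 < ‖y 0‖}, g y ∂ν)) := by
  have hf := hν.finiteAwayFromZero
  have hνreal : ∀ t : ℝ, 0 < t → ν.real {y | t < ‖y 0‖} = t ^ (-α) := fun t ht => by
    rw [measureReal_def, hν.measure_lt_norm hmeas hα ht, ENNReal.toReal_ofReal (by positivity)]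
  have hlim : Tendsto (fun b : ℝ => 2 * (C * (1 - b ^ (-α)))) (𝓝[>] 1) (𝓝 0) := by
    have h1 : ContinuousAt (fun b : ℝ => 2 * (C * (1 - b ^ (-α)))) 1 := by
      have := Real.continuousAt_rpow_const 1 (-α) (Or.inl one_ne_zero)
      fun_prop
    have h2 := h1.tendsto
    simp only [Real.one_rpow, sub_self, mul_zero] at h2
    exact h2.mono_left nhdsWithin_le_nhds
  rw [Metric.tendsto_nhds]
  intro ε hε
  obtain ⟨b, hbε, hb⟩ := ((hlim.eventually_lt_const hε).and self_mem_nhdsWithin).exists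
  have hb : 1 < b := hb
  have hT := hν.tendsto_test (isTest_mul_ramp one_pos hb hg ⟨C, hC⟩ hn)
  -- The bound collects the shell error for finite `u`, the convergence error of the ramp integral,
  -- and the shell error for `ν`.
  have hbd : Tendsto (fun u : ℝ =>
      C * (1 - P.real {ω | b * u < ‖X 0 ω‖} / P.real {ω | u < ‖X 0 ω‖}) +
      |(∫ ω, g (fun j => u⁻¹ • X j ω) * ramp 1 b (fun j => u⁻¹ • X j ω) ∂P) /
        P.real {ω | u < ‖X 0 ω‖} - ∫ y, g y * ramp 1 b y ∂ν| + C * (1 - b ^ (-α))) atTop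
      (𝓝 (C * (1 - b ^ (-α)) + |(∫ y, g y * ramp 1 b y ∂ν) - ∫ y, g y * ramp 1 b y ∂ν| +
        C * (1 - b ^ (-α)))) :=
    ((((hα b (by linarith)).const_sub 1).const_mul C).add (hT.sub_const _).abs).add_const _
  rw [sub_self, abs_zero, add_zero, ← two_mul] at hbd
  filter_upwards [hbd.eventually_lt_const hbε, eventually_gt_atTop 0] with u hu hu0
  refine lt_of_le_of_lt ?_ hu
  have hXm : Measurable fun ω (j : ℤ) => u⁻¹ • X j ω :=
    measurable_pi_lambda _ fun j => (hmeas j).const_smul _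
  have hV := hν.tail_pos u
  have hpre : ∀ t : ℝ, (fun ω (j : ℤ) => u⁻¹ • X j ω) ⁻¹' {y | t < ‖y 0‖}
      = {ω | t * u < ‖X 0 ω‖} := by
    intro t
    ext ω
    simp only [Set.mem_preimage, Set.mem_ofPred_eq]
    rw [norm_smul, norm_inv, Real.norm_of_nonneg hu0.le, lt_inv_mul_iff₀ hu0, mul_comm]
  have h1 := abs_setIntegral_sub_integral_mul_ramp_le (m := P.map fun ω (j : ℤ) => u⁻¹ • X j ω)
    hg hC hb (measure_lt_top _ _)
  rw [setIntegral_map (measurableSet_lt_norm_zero 1) hg.aestronglyMeasurable hXm.aemeasurable,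
    integral_map hXm.aemeasurable (f := fun y => g y * ramp 1 b y)
      (hg.mul (continuous_ramp 1 b)).aestronglyMeasurable,
    map_measureReal_apply hXm (measurableSet_lt_norm_zero 1),
    map_measureReal_apply hXm (measurableSet_lt_norm_zero b), hpre, hpre, one_mul] at h1
  have h2 := abs_setIntegral_sub_integral_mul_ramp_le (m := ν) hg hC hb (hf.finite 0 1 one_pos)
  rw [hνreal 1 one_pos, hνreal b (by linarith), Real.one_rpow, abs_sub_comm] at h2
  have h3 : |(∫ ω in {ω | u < ‖X 0 ω‖}, g (fun j => u⁻¹ • X j ω) ∂P) / P.real {ω | u < ‖X 0 ω‖} -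
      (∫ ω, g (fun j => u⁻¹ • X j ω) * ramp 1 b (fun j => u⁻¹ • X j ω) ∂P) /
        P.real {ω | u < ‖X 0 ω‖}|
      ≤ C * (1 - P.real {ω | b * u < ‖X 0 ω‖} / P.real {ω | u < ‖X 0 ω‖}) := by
    rw [← sub_div, abs_div, abs_of_pos hV, div_le_iff₀ hV, mul_assoc, sub_mul, one_mul,
      div_mul_cancel₀ _ hV.ne']
    exact h1
  rw [Real.dist_eq]
  have h4 := abs_sub_le ((∫ ω in {ω | u < ‖X 0 ω‖}, g (fun j => u⁻¹ • X j ω) ∂P) /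
    P.real {ω | u < ‖X 0 ω‖})
    ((∫ ω, g (fun j => u⁻¹ • X j ω) * ramp 1 b (fun j => u⁻¹ • X j ω) ∂P) /
        P.real {ω | u < ‖X 0 ω‖}) (∫ y in {y | 1 < ‖y 0‖}, g y ∂ν)
  have h5 := abs_sub_le ((∫ ω, g (fun j => u⁻¹ • X j ω) * ramp 1 b (fun j => u⁻¹ • X j ω) ∂P) /
        P.real {ω | u < ‖X 0 ω‖}) (∫ y, g y * ramp 1 b y ∂ν) (∫ y in {y | 1 < ‖y 0‖}, g y ∂ν)
  linarith

/-- The restriction of the tail measure to `{1 < ‖y 0‖}` is the law of the tail process. -/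
theorem IsTailMeasure.isTailProcess (hν : IsTailMeasure P X ν)
    (hmeas : ∀ j, Measurable (X j)) {α : ℝ}
    (hα : ∀ c : ℝ, 0 < c →
      Tendsto (fun u : ℝ => P.real {ω | c * u < ‖X 0 ω‖} / P.real {ω | u < ‖X 0 ω‖}) atTop
        (𝓝 (c ^ (-α)))) :
    IsTailProcess P X α (ν.restrict {y | 1 < ‖y 0‖}) where
  prob := ⟨by
    rw [Measure.restrict_apply_univ, hν.measure_lt_norm hmeas hα one_pos, Real.one_rpow,
      ENNReal.ofReal_one]⟩
  pareto t ht := by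
    rw [Measure.restrict_apply (measurableSet_lt_norm_zero t), Set.inter_eq_left.2]
    swap
    · exact fun y (hy : t < ‖y 0‖) => show 1 < ‖y 0‖ from ht.trans_lt hy
    exact hν.measure_lt_norm hmeas hα (by linarith)
  tendsto s t _ f := by
    have h := hν.tendsto_setIntegral hmeas hα (g := fun y => f (fun j => y j))
      -- The symmetric window must contain `[s, t]`.
      (n := max s.natAbs t.natAbs)
      (f.continuous.comp (continuous_pi fun j => continuous_apply _))
      (fun y => f.norm_coe_le_norm _) fun y => by
        congr 1
        ext ⟨j, h1, h2⟩
        exact trunc_apply_of_mem (j := j) (by omega) y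
    refine h.congr fun u => ?_
    rw [ProbabilityTheory.cond, integral_smul_measure, smul_eq_mul, ENNReal.toReal_inv,
      div_eq_inv_mul, measureReal_def]

end TailProcessLaw

/-! ### Anchoring at exceedances and mass exchange -/

section Anchors

theorem tsum_indicator_eq_one {E : Type*} {A : Set (ℤ → E)} {y : ℤ → E}
    (h : ∃! k, seqShift k y ∈ A) :
    ∑' k : ℤ, A.indicator (fun _ => (1 : ℝ≥0∞)) (seqShift k y) = 1 := by
  obtain ⟨k, hk, huniq⟩ := h
  rw [tsum_eq_single k, Set.indicator_of_mem hk]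
  exact fun l hl => Set.indicator_of_notMem (fun hmem => hl (huniq l hmem)) _

variable {E : Type*} [NormedAddCommGroup E]

/-- The sequences for which time zero is the first exceedance of the level `s`. -/
def firstExc (E : Type*) [NormedAddCommGroup E] (s : ℝ) : Set (ℤ → E) :=
  {y | (∀ j : ℤ, j ≤ -1 → ‖y j‖ ≤ s) ∧ s < ‖y 0‖}

/-- The sequences for which time zero is the last exceedance of the level `s`. -/
def lastExc (E : Type*) [NormedAddCommGroup E] (s : ℝ) : Set (ℤ → E) :=
  {y | (∀ j : ℤ, 1 ≤ j → ‖y j‖ ≤ s) ∧ s < ‖y 0‖}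

theorem finite_lt_norm {y : ℤ → E} (hy : y ∈ ell0 E) {s : ℝ} (hs : 0 < s) :
    {j : ℤ | s < ‖y j‖}.Finite := by
  have h := (tendsto_zero_iff_norm_tendsto_zero.1
    (show Tendsto y cofinite (𝓝 0) from hy)).eventually_lt_const hs
  rw [eventually_cofinite] at h
  exact h.subset fun j (hj : s < ‖y j‖) => not_lt.2 hj.le

/-- In `ℓ₀` the exceedance times form a finite set, which here is nonempty; the required shift is
minus its minimum. -/
theorem existsUnique_seqShift_mem_firstExc {y : ℤ → E} (hy : y ∈ ell0 E) {s : ℝ} (hs : 0 < s)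
    (hne : ∃ j, s < ‖y j‖) : ∃! k, seqShift k y ∈ firstExc E s := by
  obtain ⟨i, hi, hmin⟩ := Set.exists_min_image _ id (finite_lt_norm hy hs) hne
  have hi : s < ‖y i‖ := hi
  refine ⟨-i, ⟨fun j hj => ?_, ?_⟩, fun k hk => ?_⟩
  · by_contra! hlt
    have := hmin (j - -i) hlt
    simp only [id] at this
    omega
  · simpa [seqShift] using hi
  · obtain ⟨h1, h2⟩ := hk
    have h3 : i ≤ 0 - k := hmin (0 - k) h2
    by_contra hne
    have h4 := h1 (i + k) (by omega)
    simp only [seqShift, add_sub_cancel_right] at h4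
    linarith

theorem existsUnique_seqShift_mem_lastExc {y : ℤ → E} (hy : y ∈ ell0 E) {s : ℝ} (hs : 0 < s)
    (hne : ∃ j, s < ‖y j‖) : ∃! k, seqShift k y ∈ lastExc E s := by
  obtain ⟨i, hi, hmax⟩ := Set.exists_max_image _ id (finite_lt_norm hy hs) hne
  have hi : s < ‖y i‖ := hi
  refine ⟨-i, ⟨fun j hj => ?_, ?_⟩, fun k hk => ?_⟩
  · by_contra! hlt
    have := hmax (j - -i) hlt
    simp only [id] at this
    omega
  · simpa [seqShift] using hi
  · obtain ⟨h1, h2⟩ := hk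
    have h3 : 0 - k ≤ i := hmax (0 - k) h2
    by_contra hne
    have h4 := h1 (i + k) (by omega)
    simp only [seqShift, add_sub_cancel_right] at h4
    linarith

theorem lt_sup_of_lt_norm {y : ℤ → E} (hy : y ∈ ell0 E) {s : ℝ} {j : ℤ} (hj : s < ‖y j‖) :
    s < (toCluster y).sup :=
  hj.trans_le ((sup_toCluster_le_iff hy (ClusterSpace.sup_nonneg _)).1 le_rfl j)

variable [MeasurableSpace E] [BorelSpace E]

theorem measurableSet_firstExc (s : ℝ) : MeasurableSet (firstExc E s) := by
  have h : firstExc E s = (⋂ j : ℤ, ⋂ _ : j ≤ -1, {y | ‖y j‖ ≤ s}) ∩ {y | s < ‖y 0‖} := by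
    ext y
    simp [firstExc]
  rw [h]
  refine (MeasurableSet.iInter fun j => .iInter fun _ => ?_).inter (measurableSet_lt_norm_zero s)
  exact measurableSet_le (by fun_prop) measurable_const

theorem measurableSet_lastExc (s : ℝ) : MeasurableSet (lastExc E s) := by
  have h : lastExc E s = (⋂ j : ℤ, ⋂ _ : 1 ≤ j, {y | ‖y j‖ ≤ s}) ∩ {y | s < ‖y 0‖} := by
    ext y
    simp [lastExc]
  rw [h]
  refine (MeasurableSet.iInter fun j => .iInter fun _ => ?_).inter (measurableSet_lt_norm_zero s)
  exact measurableSet_le (by fun_prop) measurable_const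

variable [SecondCountableTopology E]

/-- Mass exchange: for a shift-invariant measure, a shift-invariant function has the same integral
over any two sets that meet each relevant orbit exactly once. -/
theorem setLIntegral_anchor_eq {ν : Measure (ℤ → E)} (hinv : ∀ k, ν.map (seqShift k) = ν)
    {g : (ℤ → E) → ℝ≥0∞} (hg : Measurable g) (hgs : ∀ k y, g (seqShift k y) = g y)
    {A B : Set (ℤ → E)} (hA : MeasurableSet A) (hB : MeasurableSet B)
    (hA1 : ∀ᵐ y ∂ν, g y ≠ 0 → ∃! k, seqShift k y ∈ A)
    (hB1 : ∀ᵐ y ∂ν, g y ≠ 0 → ∃! k, seqShift k y ∈ B) :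
    ∫⁻ y in A, g y ∂ν = ∫⁻ y in B, g y ∂ν := by
  have hms : ∀ k : ℤ, Measurable (seqShift k : (ℤ → E) → ℤ → E) := fun k =>
    (continuous_seqShift k).measurable
  have hone : ∀ {D : Set (ℤ → E)}, MeasurableSet D →
      Measurable (D.indicator fun _ => (1 : ℝ≥0∞)) := fun hD => measurable_const.indicator hD
  -- Inserts the factor `∑ k, 1_D (B ^ k y)`, which equals one wherever `g` does not vanish.
  have hexp : ∀ {C D : Set (ℤ → E)}, MeasurableSet C → MeasurableSet D →
      (∀ᵐ y ∂ν, g y ≠ 0 → ∃! k, seqShift k y ∈ D) →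
      ∫⁻ y in C, g y ∂ν = ∑' k : ℤ, ∫⁻ y, C.indicator (fun _ => 1) y * g y *
        D.indicator (fun _ => 1) (seqShift k y) ∂ν := by
    intro C D hC hD hD1
    have hm : ∀ k : ℤ, Measurable fun y => C.indicator (fun _ => 1) y * g y *
        D.indicator (fun _ => (1 : ℝ≥0∞)) (seqShift k y) := fun k =>
      (((hone hC).mul hg).mul ((hone hD).comp (hms k)))
    rw [← lintegral_indicator hC, ← lintegral_tsum fun k => (hm k).aemeasurable]
    refine lintegral_congr_ae ?_
    filter_upwards [hD1] with y hy
    rw [ENNReal.tsum_mul_left]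
    by_cases h0 : g y = 0
    · by_cases hyC : y ∈ C <;> simp [hyC, h0]
    · rw [tsum_indicator_eq_one (hy h0), mul_one]
      by_cases hyC : y ∈ C <;> simp [hyC]
  -- After reindexing by `k ↦ -k`, invariance under `B ^ k` carries each term of one expansion to
  -- the corresponding term of the other.
  rw [hexp hA hB hB1, hexp hB hA hA1, ← (Equiv.neg ℤ).tsum_eq]
  refine tsum_congr fun k => ?_
  have hm : Measurable fun y => A.indicator (fun _ => 1) y * g y *
      B.indicator (fun _ => (1 : ℝ≥0∞)) (seqShift (-k) y) :=
    (((hone hA).mul hg).mul ((hone hB).comp (hms _)))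
  rw [Equiv.neg_apply]
  nth_rewrite 1 [← hinv k]
  rw [lintegral_map hm (hms k)]
  refine lintegral_congr fun y => ?_
  rw [hgs, seqShift_seqShift, neg_add_cancel, seqShift_zero]
  ring

/-- The level that defines the anchor is immaterial as long as every class where `g` is nonzero
exceeds both levels. -/
theorem setLIntegral_firstExc_eq {ν : Measure (ℤ → E)} (hinv : ∀ k, ν.map (seqShift k) = ν)
    (hsupp : ∀ᵐ y ∂ν, y ∈ ell0 E) {g : ClusterSpace E → ℝ≥0∞} (hg : Measurable g) {s t : ℝ}
    (hs : 0 < s) (ht : 0 < t) (hgs : ∀ a, a.sup ≤ s → g a = 0) (hgt : ∀ a, a.sup ≤ t → g a = 0) :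
    ∫⁻ y in firstExc E s, g (toCluster y) ∂ν = ∫⁻ y in firstExc E t, g (toCluster y) ∂ν := by
  have key : ∀ s : ℝ, 0 < s → (∀ a, a.sup ≤ s → g a = 0) →
      ∀ᵐ y ∂ν, g (toCluster y) ≠ 0 → ∃! k, seqShift k y ∈ firstExc E s := by
    intro s hs hgs
    filter_upwards [hsupp] with y hy hne
    refine existsUnique_seqShift_mem_firstExc hy hs ?_
    rw [← lt_sup_toCluster_iff hy hs.le]
    by_contra! hle
    exact hne (hgs _ hle)
  exact setLIntegral_anchor_eq hinv (hg.comp measurable_toCluster)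
    (fun k y => congrArg g (toCluster_shift y k)) (measurableSet_firstExc s)
    (measurableSet_firstExc t) (key s hs hgs) (key t ht hgt)

/-- Mass exchange for the indicator of `s < sup`. It reconciles the extremal index, defined through
the future, with the law of `Q`, conditioned on the past. -/
theorem measure_lastExc_eq_firstExc {ν : Measure (ℤ → E)} (hinv : ∀ k, ν.map (seqShift k) = ν)
    (hsupp : ∀ᵐ y ∂ν, y ∈ ell0 E) {s : ℝ} (hs : 0 < s) :
    ν (lastExc E s) = ν (firstExc E s) := by
  let g : ClusterSpace E → ℝ≥0∞ := {a | s < a.sup}.indicator fun _ => 1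
  have hgm : Measurable g := measurable_const.indicator
    (measurableSet_lt measurable_const ClusterSpace.continuous_sup.measurable)
  have hg : ∀ y ∈ ell0 E, g (toCluster y) ≠ 0 → ∃ j, s < ‖y j‖ := by
    intro y hy hne
    rw [← lt_sup_toCluster_iff hy hs.le]
    exact Set.mem_of_indicator_ne_zero (s := {a : ClusterSpace E | s < a.sup}) hne
  have h := setLIntegral_anchor_eq (g := fun y => g (toCluster y)) hinv
    (hgm.comp measurable_toCluster)
    (fun k y => congrArg g (toCluster_shift y k)) (measurableSet_lastExc s)
    (measurableSet_firstExc s) (by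
      filter_upwards [hsupp] with y hy hne using
        existsUnique_seqShift_mem_lastExc hy hs (hg y hy hne)) (by
      filter_upwards [hsupp] with y hy hne using
        existsUnique_seqShift_mem_firstExc hy hs (hg y hy hne))
  have hone : ∀ A : Set (ℤ → E), MeasurableSet A → (∀ y ∈ A, s < ‖y 0‖) →
      ∫⁻ y in A, g (toCluster y) ∂ν = ν A := by
    intro A hA hlt
    rw [← setLIntegral_one]
    refine setLIntegral_congr_fun_ae hA ?_
    filter_upwards [hsupp] with y hy hyA
    exact Set.indicator_of_mem (s := {a : ClusterSpace E | s < a.sup})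
      (show s < (toCluster y).sup from lt_sup_of_lt_norm hy (hlt y hyA)) _
  rwa [hone _ (measurableSet_lastExc s) fun y hy => hy.2,
    hone _ (measurableSet_firstExc s) fun y hy => hy.2] at h

end Anchors

/-! ### The measure `ν*` as an integral over first exceedances -/

section SpectralDecomposition

theorem setLIntegral_Ioi_comp_mul {φ : ℝ → ℝ≥0∞} (hφ : Measurable φ) {S : ℝ} (hS : 0 < S) :
    ∫⁻ r in Set.Ioi 0, φ r = ENNReal.ofReal S * ∫⁻ t in Set.Ioi 0, φ (S * t) := by
  rw [← lintegral_indicator measurableSet_Ioi, ← lintegral_indicator measurableSet_Ioi]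
  nth_rewrite 1 [← Real.smul_map_volume_mul_left hS.ne']
  rw [lintegral_smul_measure, lintegral_map (hφ.indicator measurableSet_Ioi)
    (measurable_const_mul S), abs_of_pos hS, smul_eq_mul]
  congr 1
  refine lintegral_congr fun t => ?_
  by_cases ht : 0 < t
  · rw [Set.indicator_of_mem (Set.mem_Ioi.2 ht),
      Set.indicator_of_mem (Set.mem_Ioi.2 (mul_pos hS ht))]
  · rw [Set.indicator_of_notMem (a := t) (s := Set.Ioi 0) ht, Set.indicator_of_notMem]
    rwa [Set.mem_Ioi, mul_pos_iff_of_pos_left hS]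

theorem setLIntegral_Ioi_rpow {α : ℝ} (hα : 0 < α) {S : ℝ} (hS : 0 ≤ S) :
    ∫⁻ t in Set.Ioi 0, ENNReal.ofReal (α * t ^ (α - 1)) *
      {t : ℝ | t < S}.indicator (fun _ => 1) t = ENNReal.ofReal (S ^ α) := by
  have h1 : ∀ t : ℝ, ENNReal.ofReal (α * t ^ (α - 1)) *
      {t : ℝ | t < S}.indicator (fun _ => 1) t =
      (Set.Iio S).indicator (fun t => ENNReal.ofReal (α * t ^ (α - 1))) t := by
    intro t
    by_cases ht : t < S
    · rw [Set.indicator_of_mem (s := {t : ℝ | t < S}) ht, mul_one,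
        Set.indicator_of_mem (Set.mem_Iio.2 ht)]
    · rw [Set.indicator_of_notMem (s := {t : ℝ | t < S}) ht, mul_zero,
        Set.indicator_of_notMem (by simpa using ht)]
  simp only [h1]
  rw [lintegral_indicator measurableSet_Iio, Measure.restrict_restrict measurableSet_Iio,
    Set.inter_comm, Set.Ioi_inter_Iio, restrict_Ioo_eq_restrict_Ioc]
  have hi : IntervalIntegrable (fun t : ℝ => α * t ^ (α - 1)) volume 0 S :=
    (intervalIntegral.intervalIntegrable_rpow' (by linarith)).const_mul α
  rw [← ofReal_integral_eq_lintegral_ofReal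
    ((intervalIntegrable_iff_integrableOn_Ioc_of_le hS).1 hi), ← intervalIntegral.integral_of_le hS,
    intervalIntegral.integral_const_mul, integral_rpow (Or.inl (by linarith))]
  · congr 1
    rw [sub_add_cancel, Real.zero_rpow hα.ne', sub_zero]
    field_simp
  · filter_upwards [ae_restrict_mem measurableSet_Ioc] with t ht
    have := ht.1
    positivity

theorem measurable_sup_toCluster {E : Type*} [NormedAddCommGroup E] [MeasurableSpace E]
    [BorelSpace E] [SecondCountableTopology E] :
    Measurable fun y : ℤ → E => (toCluster y).sup :=
  ClusterSpace.continuous_sup.measurable.comp measurable_toCluster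

variable {E : Type*} [NormedAddCommGroup E] [NormedSpace ℝ E]

theorem smul_mem_ell0 {y : ℤ → E} (hy : y ∈ ell0 E) (c : ℝ) : c • y ∈ ell0 E := by
  have h := Tendsto.const_smul (show Tendsto y cofinite (𝓝 0) from hy) c
  rwa [smul_zero] at h

theorem sup_toCluster_smul {y : ℤ → E} (hy : y ∈ ell0 E) {c : ℝ} (hc : 0 ≤ c) :
    (toCluster (c • y)).sup = c * (toCluster y).sup := by
  rw [← iSup_norm_eq hy, ← iSup_norm_eq (smul_mem_ell0 hy c), Real.mul_iSup_of_nonneg hc]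
  simp only [Pi.smul_apply, norm_smul, Real.norm_of_nonneg hc]

theorem smul_mem_firstExc_iff {y : ℤ → E} {c s : ℝ} (hc : 0 < c) :
    c • y ∈ firstExc E (c * s) ↔ y ∈ firstExc E s := by
  simp only [firstExc, Set.mem_ofPred_eq, Pi.smul_apply, norm_smul, Real.norm_of_nonneg hc.le,
    mul_le_mul_iff_right₀ hc, mul_lt_mul_iff_right₀ hc]

variable [MeasurableSpace E] [BorelSpace E] [SecondCountableTopology E] {ν : Measure (ℤ → E)}

/-- The factor `ϑ` cancels the normalization of the conditional law: it is the mass of `lastExc E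
1`, equal by mass exchange to that of the conditioning event `firstExc E 1`. -/
theorem extremalIndex_smul_lawQ (hf : FiniteAwayFromZero ν)
    (hinv : ∀ k, ν.map (seqShift k) = ν) (hsupp : ∀ᵐ y ∂ν, y ∈ ell0 E) :
    extremalIndex (ν.restrict {y | 1 < ‖y 0‖}) • lawQ (ν.restrict {y | 1 < ‖y 0‖}) =
      (ν.restrict (firstExc E 1)).map fun y => (⨆ j, ‖y j‖)⁻¹ • y := by
  have hpast : MeasurableSet {y : ℤ → E | ∀ j : ℤ, j ≤ -1 → ‖y j‖ ≤ 1} := by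
    simp only [Set.ofPred_forall]
    exact .iInter fun j => .iInter fun _ => measurableSet_le (by fun_prop) measurable_const
  have hfut : MeasurableSet {y : ℤ → E | ∀ j : ℤ, 1 ≤ j → ‖y j‖ ≤ 1} := by
    simp only [Set.ofPred_forall]
    exact .iInter fun j => .iInter fun _ => measurableSet_le (by fun_prop) measurable_const
  have hϑ : extremalIndex (ν.restrict {y | 1 < ‖y 0‖}) = ν (firstExc E 1) := by
    rw [← measure_lastExc_eq_firstExc hinv hsupp one_pos, extremalIndex,
      Measure.restrict_apply hfut]
    rfl
  have hfin : ν (firstExc E 1) ≠ ∞ :=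
    (lt_of_le_of_lt (measure_mono fun y hy => hy.2) (hf.finite 0 1 one_pos)).ne
  rw [hϑ, lawQ, ProbabilityTheory.cond, Measure.restrict_apply hpast,
    Measure.restrict_restrict hpast]
  change _ • Measure.map _ ((ν (firstExc E 1))⁻¹ • ν.restrict (firstExc E 1)) = _
  rw [Measure.map_smul, smul_smul]
  -- In the degenerate case both sides vanish, so positivity of the extremal index is not required.
  by_cases h0 : ν (firstExc E 1) = 0
  · rw [Measure.restrict_eq_zero.2 h0, Measure.map_zero, smul_zero]
  · rw [ENNReal.mul_inv_cancel h0 hfin, one_smul]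

theorem measurable_normalize : Measurable fun y : ℤ → E => (⨆ j, ‖y j‖)⁻¹ • y := by
  have h : Measurable fun y : ℤ → E => ⨆ j, ‖y j‖ := Measurable.iSup fun j => by fun_prop
  exact h.inv.smul measurable_id

theorem measurable_radial_smul : Measurable fun p : ℝ × (ℤ → E) => p.1 • p.2 :=
  measurable_fst.smul measurable_snd

theorem lintegral_nuStarSeq (hf : FiniteAwayFromZero ν)
    (hinv : ∀ k, ν.map (seqShift k) = ν) (hsupp : ∀ᵐ y ∂ν, y ∈ ell0 E) (α : ℝ)
    {G : (ℤ → E) → ℝ≥0∞} (hG : Measurable G) :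
    ∫⁻ y, G y ∂(nuStarSeq α (ν.restrict {y | 1 < ‖y 0‖})) =
      ∫⁻ r in Set.Ioi 0, ENNReal.ofReal (α * r ^ (-α - 1)) *
        ∫⁻ y in firstExc E 1, G (r • (⨆ j, ‖y j‖)⁻¹ • y) ∂ν := by
  have hw : Measurable fun r : ℝ => ENNReal.ofReal (α * r ^ (-α - 1)) := by fun_prop
  have hfin : IsFiniteMeasure (ν.restrict {y | 1 < ‖y 0‖}) :=
    ⟨by rw [Measure.restrict_apply_univ]; exact hf.finite 0 1 one_pos⟩
  have : SFinite (lawQ (ν.restrict {y | 1 < ‖y 0‖})) := by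
    unfold lawQ
    infer_instance
  have : SFinite (ν.restrict (firstExc E 1)) := by
    have : IsFiniteMeasure (ν.restrict (firstExc E 1)) := ⟨by
      rw [Measure.restrict_apply_univ]
      exact lt_of_le_of_lt (measure_mono fun y hy => hy.2) (hf.finite 0 1 one_pos)⟩
    infer_instance
  have hGp : Measurable fun p : ℝ × (ℤ → E) => G (p.1 • p.2) := hG.comp measurable_radial_smul
  rw [nuStarSeq, lintegral_smul_measure, lintegral_map hG measurable_radial_smul,
    lintegral_prod _ hGp.aemeasurable, smul_eq_mul, ← lintegral_const_mul _
      hGp.lintegral_prod_right']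
  have h1 : ∀ r : ℝ, extremalIndex (ν.restrict {y | 1 < ‖y 0‖}) *
      ∫⁻ q, G (r • q) ∂(lawQ (ν.restrict {y | 1 < ‖y 0‖})) =
      ∫⁻ y in firstExc E 1, G (r • (⨆ j, ‖y j‖)⁻¹ • y) ∂ν := by
    intro r
    have hGr : Measurable fun q : ℤ → E => G (r • q) := hG.comp (measurable_id.const_smul r)
    rw [← smul_eq_mul, ← lintegral_smul_measure, extremalIndex_smul_lawQ hf hinv hsupp,
      lintegral_map hGr measurable_normalize]
  simp only [h1]
  have hm2 : Measurable fun r : ℝ => ∫⁻ y in firstExc E 1, G (r • (⨆ j, ‖y j‖)⁻¹ • y) ∂ν := by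
    have : Measurable fun p : ℝ × (ℤ → E) => G (p.1 • (⨆ j, ‖p.2 j‖)⁻¹ • p.2) :=
      hG.comp (measurable_fst.smul (measurable_normalize.comp measurable_snd))
    exact this.lintegral_prod_right'
  rw [radialMeasure, lintegral_withDensity_eq_lintegral_mul _ hw hm2]
  rfl

/-- The measure `ν*` in terms of the tail measure. -/
theorem lintegral_nuStar (hf : FiniteAwayFromZero ν)
    (hinv : ∀ k, ν.map (seqShift k) = ν) (hsupp : ∀ᵐ y ∂ν, y ∈ ell0 E) {α : ℝ} (hα : 0 < α)
    (hhom : ∀ c : ℝ, 0 < c → ν.map (fun y => c • y) = ENNReal.ofReal (c ^ α) • ν)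
    {g : ClusterSpace E → ℝ≥0∞} (hg : Measurable g) {ε : ℝ} (hε : 0 < ε)
    (hgε : ∀ a, a.sup ≤ ε → g a = 0) :
    ∫⁻ a, g a ∂(nuStar α (ν.restrict {y | 1 < ‖y 0‖})) =
      ∫⁻ y in firstExc E ε, g (toCluster y) ∂ν := by
  have hG : Measurable fun y : ℤ → E => g (toCluster y) := hg.comp measurable_toCluster
  have hS := measurable_sup_toCluster (E := E)
  have hw : Measurable fun r : ℝ => ENNReal.ofReal (α * r ^ (-α - 1)) := by fun_prop
  have hfinF : ∀ s : ℝ, 0 < s → IsFiniteMeasure (ν.restrict (firstExc E s)) := fun s hs => ⟨by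
    rw [Measure.restrict_apply_univ]
    exact lt_of_le_of_lt (measure_mono fun y hy => hy.2) (hf.finite 0 s hs)⟩
  have := hfinF 1 one_pos
  have := hfinF ε hε
  have haeF : ∀ s : ℝ, 0 < s →
      ∀ᵐ y ∂(ν.restrict (firstExc E s)), y ∈ ell0 E ∧ s < (toCluster y).sup := by
    intro s hs
    filter_upwards [ae_restrict_of_ae hsupp, ae_restrict_mem (measurableSet_firstExc s)] with y hy h
    exact ⟨hy, lt_sup_of_lt_norm hy h.2⟩
  -- the function `W`, homogeneous of degree `-α` up to the factor `g`
  let W : ClusterSpace E → ℝ≥0∞ := fun a => ENNReal.ofReal (a.sup ^ (-α)) * g a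
  have hW : Measurable W :=
    ((ClusterSpace.continuous_sup.measurable.pow_const (-α)).ennreal_ofReal).mul hg
  rw [nuStar, lintegral_map hg measurable_toCluster, lintegral_nuStarSeq hf hinv hsupp α hG]
  have hjoint : Measurable fun p : ℝ × (ℤ → E) => ENNReal.ofReal (α * p.1 ^ (-α - 1)) *
      g (toCluster (p.1 • (⨆ j, ‖p.2 j‖)⁻¹ • p.2)) :=
    (hw.comp measurable_fst).mul
      (hG.comp (measurable_fst.smul (measurable_normalize.comp measurable_snd)))
  have hjoint2 : Measurable fun p : ℝ × (ℤ → E) => ENNReal.ofReal (α * p.1 ^ (-α - 1)) *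
      (ENNReal.ofReal ((toCluster p.2).sup ^ (-α)) * g (toCluster (p.1 • p.2))) :=
    (hw.comp measurable_fst).mul ((((hS.comp measurable_snd).pow_const (-α)).ennreal_ofReal).mul
      (hG.comp measurable_radial_smul))
  have hswap : ∫⁻ r in Set.Ioi 0, ENNReal.ofReal (α * r ^ (-α - 1)) *
        ∫⁻ y in firstExc E 1, g (toCluster (r • (⨆ j, ‖y j‖)⁻¹ • y)) ∂ν =
      ∫⁻ y in firstExc E 1, (∫⁻ r in Set.Ioi 0, ENNReal.ofReal (α * r ^ (-α - 1)) *
        g (toCluster (r • (⨆ j, ‖y j‖)⁻¹ • y))) ∂ν := by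
    rw [← lintegral_lintegral_swap hjoint.aemeasurable]
    refine lintegral_congr fun r => (lintegral_const_mul _ ?_).symm
    exact hG.comp (measurable_normalize.const_smul r)
  -- Substitution `r = y* t` with `y* = sup_j ‖y_j‖`: the normalization of `y` disappears and the
  -- radial density produces the weight `(y*) ^ (-α)`.
  have hpolar : ∫⁻ y in firstExc E 1, (∫⁻ r in Set.Ioi 0, ENNReal.ofReal (α * r ^ (-α - 1)) *
        g (toCluster (r • (⨆ j, ‖y j‖)⁻¹ • y))) ∂ν =
      ∫⁻ y in firstExc E 1, (∫⁻ t in Set.Ioi 0, ENNReal.ofReal (α * t ^ (-α - 1)) *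
        (ENNReal.ofReal ((toCluster y).sup ^ (-α)) * g (toCluster (t • y)))) ∂ν := by
    refine lintegral_congr_ae ?_
    filter_upwards [haeF 1 one_pos] with y hy
    have hpos : 0 < (toCluster y).sup := one_pos.trans hy.2
    have hm : Measurable fun r : ℝ => ENNReal.ofReal (α * r ^ (-α - 1)) *
        g (toCluster (r • (⨆ j, ‖y j‖)⁻¹ • y)) :=
      hjoint.comp (measurable_id.prodMk measurable_const)
    rw [setLIntegral_Ioi_comp_mul hm hpos,
      ← lintegral_const_mul' _ _ ENNReal.ofReal_ne_top]
    refine setLIntegral_congr_fun measurableSet_Ioi fun t ht => ?_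
    have ht : 0 < t := ht
    simp only [iSup_norm_eq hy.1]
    rw [smul_smul, mul_right_comm, mul_inv_cancel₀ hpos.ne', one_mul, ← mul_assoc, ← mul_assoc,
      ← ENNReal.ofReal_mul hpos.le, ← ENNReal.ofReal_mul (by positivity)]
    congr 2
    rw [Real.mul_rpow hpos.le ht.le, Real.rpow_sub_one hpos.ne']
    field_simp
  have hswap_back : ∫⁻ y in firstExc E 1, (∫⁻ t in Set.Ioi 0, ENNReal.ofReal (α * t ^ (-α - 1)) *
        (ENNReal.ofReal ((toCluster y).sup ^ (-α)) * g (toCluster (t • y)))) ∂ν =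
      ∫⁻ t in Set.Ioi 0, ENNReal.ofReal (α * t ^ (-α - 1)) *
        ∫⁻ y in firstExc E 1, ENNReal.ofReal ((toCluster y).sup ^ (-α)) * g (toCluster (t • y))
          ∂ν := by
    rw [← lintegral_lintegral_swap hjoint2.aemeasurable]
    refine lintegral_congr fun t => lintegral_const_mul _ ?_
    exact ((hS.pow_const (-α)).ennreal_ofReal).mul (hG.comp (measurable_id.const_smul t))
  -- Change of variables `z = t • y`, mapping `firstExc E 1` to `firstExc E t`. One factor `t ^ α`
  -- comes from the homogeneity of `ν`, the other from the weight.
  have hscale : ∀ t : ℝ, 0 < t →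
      ∫⁻ y in firstExc E 1, ENNReal.ofReal ((toCluster y).sup ^ (-α)) * g (toCluster (t • y)) ∂ν =
      ENNReal.ofReal (t ^ (2 * α)) * ∫⁻ y in firstExc E t, W (toCluster y) ∂ν := by
    intro t ht
    have hWm : Measurable ((firstExc E t).indicator fun y => W (toCluster y)) :=
      (hW.comp measurable_toCluster).indicator (measurableSet_firstExc t)
    have h1 : ENNReal.ofReal (t ^ α) * ∫⁻ y in firstExc E t, W (toCluster y) ∂ν =
        ∫⁻ y, (firstExc E t).indicator (fun y => W (toCluster y)) (t • y) ∂ν := by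
      rw [← lintegral_indicator (measurableSet_firstExc t), ← smul_eq_mul,
        ← lintegral_smul_measure, ← hhom t ht,
        lintegral_map (g := fun y : ℤ → E => t • y) hWm (measurable_id.const_smul t)]
    rw [two_mul, Real.rpow_add ht, ENNReal.ofReal_mul (by positivity), mul_assoc, h1,
      ← lintegral_const_mul' _ _ ENNReal.ofReal_ne_top,
      ← lintegral_indicator (measurableSet_firstExc 1)]
    refine lintegral_congr_ae ?_
    filter_upwards [hsupp] with y hy
    have hiff := smul_mem_firstExc_iff (y := y) (s := 1) ht
    rw [mul_one] at hiff
    by_cases hmem : y ∈ firstExc E 1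
    · have hpos : 0 < (toCluster y).sup := one_pos.trans (lt_sup_of_lt_norm hy hmem.2)
      rw [Set.indicator_of_mem hmem, Set.indicator_of_mem (hiff.2 hmem)]
      simp only [W]
      rw [sup_toCluster_smul hy ht.le, ← mul_assoc, ← ENNReal.ofReal_mul (by positivity)]
      congr 2
      rw [Real.mul_rpow ht.le hpos.le, ← mul_assoc, ← Real.rpow_add ht, add_neg_cancel,
        Real.rpow_zero, one_mul]
    · rw [Set.indicator_of_notMem hmem, Set.indicator_of_notMem (fun h => hmem (hiff.1 h)),
        mul_zero]
  -- On `firstExc E t` the supremum exceeds `t`, so `W` may be cut to `{t < sup}`; it then vanishes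
  -- below both levels and the anchor can be moved from `t` to the fixed level `ε`.
  have hexchange : ∀ t : ℝ, 0 < t → ∫⁻ y in firstExc E t, W (toCluster y) ∂ν =
      ∫⁻ y in firstExc E ε, W (toCluster y) *
        {s : ℝ | s < (toCluster y).sup}.indicator (fun _ => 1) t ∂ν := by
    intro t ht
    let g' : ClusterSpace E → ℝ≥0∞ := {a | t < a.sup}.indicator W
    have hg' : Measurable g' := hW.indicator
      (measurableSet_lt measurable_const ClusterSpace.continuous_sup.measurable)
    have h1 := setLIntegral_firstExc_eq hinv hsupp hg' ht hε
      (fun a ha => Set.indicator_of_notMem (s := {a : ClusterSpace E | t < a.sup}) (not_lt.2 ha) _)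
      fun a ha => by
        by_cases hta : t < a.sup
        · refine (Set.indicator_of_mem (s := {a : ClusterSpace E | t < a.sup}) hta _).trans ?_
          simp only [W]
          rw [hgε a ha, mul_zero]
        · exact Set.indicator_of_notMem (s := {a : ClusterSpace E | t < a.sup}) hta _
    have h2 : ∫⁻ y in firstExc E t, W (toCluster y) ∂ν =
        ∫⁻ y in firstExc E t, g' (toCluster y) ∂ν := by
      refine lintegral_congr_ae ?_
      filter_upwards [haeF t ht] with y hy
      exact (Set.indicator_of_mem (s := {a : ClusterSpace E | t < a.sup}) hy.2 W).symm
    rw [h2, h1]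
    refine lintegral_congr fun y => ?_
    by_cases hty : t < (toCluster y).sup
    · rw [Set.indicator_of_mem (s := {s : ℝ | s < (toCluster y).sup}) hty, mul_one]
      exact Set.indicator_of_mem (s := {a : ClusterSpace E | t < a.sup}) hty W
    · rw [Set.indicator_of_notMem (s := {s : ℝ | s < (toCluster y).sup}) hty, mul_zero]
      exact Set.indicator_of_notMem (s := {a : ClusterSpace E | t < a.sup}) hty W
  have hind : Measurable fun p : ℝ × (ℤ → E) =>
      {s : ℝ | s < (toCluster p.2).sup}.indicator (fun _ => (1 : ℝ≥0∞)) p.1 := by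
    have : MeasurableSet {p : ℝ × (ℤ → E) | p.1 < (toCluster p.2).sup} :=
      measurableSet_lt measurable_fst (hS.comp measurable_snd)
    exact (measurable_const.indicator this : Measurable
      ({p : ℝ × (ℤ → E) | p.1 < (toCluster p.2).sup}.indicator fun _ => (1 : ℝ≥0∞)))
  have hw2 : Measurable fun t : ℝ => ENNReal.ofReal (α * t ^ (α - 1)) := by fun_prop
  have hjoint3 : Measurable fun p : ℝ × (ℤ → E) => ENNReal.ofReal (α * p.1 ^ (α - 1)) *
      (W (toCluster p.2) * {s : ℝ | s < (toCluster p.2).sup}.indicator (fun _ => 1) p.1) :=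
    (hw2.comp measurable_fst).mul
      (((hW.comp measurable_toCluster).comp measurable_snd).mul hind)
  have hcombine : ∫⁻ t in Set.Ioi 0, ENNReal.ofReal (α * t ^ (-α - 1)) *
        ∫⁻ y in firstExc E 1, ENNReal.ofReal ((toCluster y).sup ^ (-α)) * g (toCluster (t • y))
          ∂ν =
      ∫⁻ t in Set.Ioi 0, ∫⁻ y in firstExc E ε, ENNReal.ofReal (α * t ^ (α - 1)) *
        (W (toCluster y) * {s : ℝ | s < (toCluster y).sup}.indicator (fun _ => 1) t) ∂ν := by
    refine setLIntegral_congr_fun measurableSet_Ioi fun t ht => ?_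
    have ht : 0 < t := ht
    rw [hscale t ht, hexchange t ht, ← mul_assoc, ← ENNReal.ofReal_mul (by positivity),
      lintegral_const_mul' _ _ ENNReal.ofReal_ne_top]
    congr 2
    rw [mul_assoc, ← Real.rpow_add ht]
    congr 2
    ring
  -- What remains in `t` is the integral of `α t ^ (α - 1)` over `0 < t < y*`, namely `(y*) ^ α`,
  -- which cancels the weight in `W`.
  rw [hswap, hpolar, hswap_back, hcombine, lintegral_lintegral_swap hjoint3.aemeasurable]
  refine lintegral_congr_ae ?_
  filter_upwards [haeF ε hε] with y hy
  have hpos : 0 < (toCluster y).sup := hε.trans hy.2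
  have h7 : ∀ t : ℝ, ENNReal.ofReal (α * t ^ (α - 1)) *
      (W (toCluster y) * {s : ℝ | s < (toCluster y).sup}.indicator (fun _ => 1) t) =
      W (toCluster y) * (ENNReal.ofReal (α * t ^ (α - 1)) *
        {s : ℝ | s < (toCluster y).sup}.indicator (fun _ => 1) t) := fun t => by ring
  simp only [h7]
  have hm : Measurable fun t : ℝ => ENNReal.ofReal (α * t ^ (α - 1)) *
      {s : ℝ | s < (toCluster y).sup}.indicator (fun _ => 1) t :=
    hw2.mul (measurable_const.indicator (measurableSet_lt measurable_id measurable_const))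
  rw [lintegral_const_mul _ hm,
    setLIntegral_Ioi_rpow hα hpos.le]
  simp only [W]
  rw [mul_right_comm, ← ENNReal.ofReal_mul (by positivity), ← Real.rpow_add hpos, neg_add_cancel,
    Real.rpow_zero, ENNReal.ofReal_one, one_mul]

end SpectralDecomposition

/-! ### Clusters of the tail measure in growing windows -/

section ClusterLimit

/-- Convergence of the averages along antidiagonals of a bounded double sequence. -/
theorem tendsto_average_antidiagonal {h : ℕ → ℕ → ℝ} {l C : ℝ} (hC : ∀ a b, |h a b - l| ≤ C)
    (hl : Tendsto (fun p : ℕ × ℕ => h p.1 p.2) (atTop ×ˢ atTop) (𝓝 l)) :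
    Tendsto (fun r : ℕ => (r : ℝ)⁻¹ * ∑ j ∈ Finset.range r, h j (r - 1 - j)) atTop (𝓝 l) := by
  have hC0 : 0 ≤ C := (abs_nonneg _).trans (hC 0 0)
  rw [Metric.tendsto_nhds]
  intro η hη
  have h1 := Metric.tendsto_nhds.1 hl (η / 2) (half_pos hη)
  rw [prod_atTop_atTop_eq, eventually_atTop] at h1
  obtain ⟨⟨K₁, K₂⟩, hK⟩ := h1
  set K := max K₁ K₂ with hKdef
  -- Only indices within `K` of an end of the range escape the `η / 2` bound; there are at most `2K`
  -- of them, each costing at most `C`, which is negligible after division by `r`.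
  have hterm : ∀ r, ∀ j ∈ Finset.range r, |h j (r - 1 - j) - l| ≤
      η / 2 + (if j < K then C else 0) + (if r - 1 - j < K then C else 0) := by
    intro r j _
    have hx : (0 : ℝ) ≤ if j < K then C else 0 := by split_ifs <;> simp [hC0]
    have hy : (0 : ℝ) ≤ if r - 1 - j < K then C else 0 := by split_ifs <;> simp [hC0]
    have hz := hC j (r - 1 - j)
    by_cases h1 : j < K
    · rw [if_pos h1] at hx ⊢
      linarith
    · by_cases h2 : r - 1 - j < K
      · rw [if_pos h2] at hy ⊢
        linarith
      · have := hK (j, r - 1 - j) ⟨(le_max_left _ _).trans (not_lt.1 h1),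
          (le_max_right _ _).trans (not_lt.1 h2)⟩
        rw [Real.dist_eq] at this
        simp only at this
        linarith
  have hcount : ∀ r, ∑ j ∈ Finset.range r, (if j < K then C else 0) ≤ K * C := by
    intro r
    rw [← Finset.sum_filter, Finset.sum_const, nsmul_eq_mul]
    refine mul_le_mul_of_nonneg_right ?_ hC0
    have : (Finset.filter (fun j => j < K) (Finset.range r)).card ≤ (Finset.range K).card :=
      Finset.card_le_card fun j hj => by
        rw [Finset.mem_filter] at hj
        exact Finset.mem_range.2 hj.2
    rw [Finset.card_range] at this
    exact_mod_cast this
  have hcount' : ∀ r, ∑ j ∈ Finset.range r, (if r - 1 - j < K then C else 0) ≤ K * C := by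
    intro r
    rw [Finset.sum_range_reflect (fun j => if j < K then C else 0) r]
    exact hcount r
  have hlim : Tendsto (fun r : ℕ => 2 * (K * C) * (r : ℝ)⁻¹) atTop (𝓝 0) := by
    simpa using (tendsto_inv_atTop_zero.comp tendsto_natCast_atTop_atTop).const_mul (2 * (K * C))
  filter_upwards [hlim.eventually_lt_const (half_pos hη), eventually_gt_atTop 0] with r hr hr0
  have hr0' : (0 : ℝ) < r := by exact_mod_cast hr0
  have heq : (r : ℝ)⁻¹ * ∑ j ∈ Finset.range r, h j (r - 1 - j) - l =
      (r : ℝ)⁻¹ * ∑ j ∈ Finset.range r, (h j (r - 1 - j) - l) := by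
    rw [Finset.sum_sub_distrib, Finset.sum_const, Finset.card_range, nsmul_eq_mul, mul_sub,
      inv_mul_cancel_left₀ hr0'.ne']
  rw [Real.dist_eq, heq, abs_mul, abs_of_pos (inv_pos.2 hr0')]
  have hsum : |∑ j ∈ Finset.range r, (h j (r - 1 - j) - l)| ≤ r * (η / 2) + K * C + K * C := by
    refine (Finset.abs_sum_le_sum_abs _ _).trans ((Finset.sum_le_sum (hterm r)).trans ?_)
    rw [Finset.sum_add_distrib, Finset.sum_add_distrib, Finset.sum_const, Finset.card_range,
      nsmul_eq_mul]
    linarith [hcount r, hcount' r]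
  calc (r : ℝ)⁻¹ * |∑ j ∈ Finset.range r, (h j (r - 1 - j) - l)|
      ≤ (r : ℝ)⁻¹ * (r * (η / 2) + K * C + K * C) := by gcongr
    _ = η / 2 + 2 * (K * C) * (r : ℝ)⁻¹ := by field_simp; ring
    _ < η := by linarith

variable {E : Type*} [NormedAddCommGroup E]

/-- The sequences with an exceedance of `s` at time `0`, and none at the times `-a, …, -1`. -/
def firstExcWindow (E : Type*) [NormedAddCommGroup E] (s : ℝ) (a : ℕ) : Set (ℤ → E) :=
  {y | (∀ i : ℤ, -a ≤ i → i ≤ -1 → ‖y i‖ ≤ s) ∧ s < ‖y 0‖}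

theorem isTest_toCluster_trunc {f : BoundedContinuousFunction (ClusterSpace E) ℝ} {ε : ℝ}
    (hε : 0 < ε) (hf : ∀ a : ClusterSpace E, a.sup ≤ ε → f a = 0) (r : ℕ) :
    IsTest (fun y => f (toCluster (trunc 1 r y))) r ε where
  continuous := f.continuous.comp (continuous_toCluster_trunc 1 r)
  bounded := ⟨‖f‖, fun y => f.norm_coe_le_norm _⟩
  factor y := by rw [trunc_trunc _ _ _ _ (by omega) le_rfl]
  pos := hε
  zero y hy := by
    refine hf _ ((sup_toCluster_le_iff (trunc_mem_ell0 _ _ _) hε.le).2 fun j => ?_)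
    by_cases h : 1 ≤ j ∧ j ≤ (r : ℤ)
    · rw [trunc_apply_of_mem h]
      exact hy j (by omega) h.2
    · rw [trunc_apply_of_not_mem h, norm_zero]
      exact hε.le

/-- Decomposition according to the first exceedance in the window. -/
theorem sum_indicator_firstExcWindow {f : ClusterSpace E → ℝ} {ε : ℝ}
    (hε : 0 < ε) (hf : ∀ a : ClusterSpace E, a.sup ≤ ε → f a = 0) (r : ℕ) (y : ℤ → E) :
    ∑ j ∈ Finset.range r, (firstExcWindow E ε j).indicator
      (fun z => f (toCluster (trunc (-j) (r - 1 - j : ℕ) z))) (seqShift (-(j + 1)) y) =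
      f (toCluster (trunc 1 r y)) := by
  classical
  -- Index `j` stands for time `j + 1`. Moving that time to zero carries the window `[1, r]` to
  -- `[-j, r - 1 - j]`, with the same class.
  have hval : ∀ j ∈ Finset.range r,
      toCluster (trunc (-j) (r - 1 - j : ℕ) (seqShift (-(j + 1)) y)) =
        toCluster (trunc 1 r y) := by
    intro j hj
    rw [Finset.mem_range] at hj
    rw [← toCluster_shift (trunc 1 r y) (-(j + 1))]
    congr 1
    ext i
    simp only [trunc, seqShift]
    split_ifs <;> first | rfl | omega
  by_cases hex : ∃ j : ℕ, j < r ∧ ε < ‖y (j + 1)‖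
  · have h1 := Nat.find_spec hex
    have hmin := fun m => Nat.find_min (m := m) hex
    set j₀ := Nat.find hex
    rw [Finset.sum_eq_single j₀]
    · rw [Set.indicator_of_mem, hval j₀ (Finset.mem_range.2 h1.1)]
      refine ⟨fun i hi1 hi2 => ?_, ?_⟩
      · by_contra! hlt
        simp only [seqShift] at hlt
        refine hmin (i + j₀).toNat (by omega) ⟨by omega, ?_⟩
        rw [show (((i + j₀).toNat : ℕ) : ℤ) + 1 = i - -(j₀ + 1) by omega]
        exact hlt
      · simpa [seqShift] using h1.2
    · intro j hj hne
      rw [Finset.mem_range] at hj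
      refine Set.indicator_of_notMem (fun hmem => ?_) _
      obtain ⟨h2, h3⟩ := hmem
      simp only [seqShift] at h3
      rcases lt_or_gt_of_ne hne with hlt | hlt
      · refine hmin j hlt ⟨hj, ?_⟩
        simpa using h3
      · have h4 := h2 (j₀ - j) (by omega) (by omega)
        simp only [seqShift] at h4
        rw [show (j₀ : ℤ) - j - -(j + 1) = j₀ + 1 by ring] at h4
        linarith [h1.2]
    · intro h
      exact absurd (Finset.mem_range.2 h1.1) h
  · push Not at hex
    rw [hf, Finset.sum_eq_zero]
    · intro j hj
      refine Set.indicator_of_notMem (fun hmem => ?_) _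
      have h3 := hmem.2
      simp only [seqShift] at h3
      have := hex j (Finset.mem_range.1 hj)
      rw [show (0 : ℤ) - -(j + 1) = j + 1 by ring] at h3
      linarith
    · refine (sup_toCluster_le_iff (trunc_mem_ell0 _ _ _) hε.le).2 fun i => ?_
      by_cases h : 1 ≤ i ∧ i ≤ (r : ℤ)
      · rw [trunc_apply_of_mem h]
        have := hex (i - 1).toNat (by omega)
        rwa [show (((i - 1).toNat : ℕ) : ℤ) + 1 = i by omega] at this
      · rw [trunc_apply_of_not_mem h, norm_zero]
        exact hε.le

variable [MeasurableSpace E] [BorelSpace E]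

theorem measurableSet_firstExcWindow (s : ℝ) (a : ℕ) : MeasurableSet (firstExcWindow E s a) := by
  have h : firstExcWindow E s a =
      (⋂ j : ℤ, ⋂ _ : -a ≤ j, ⋂ _ : j ≤ -1, {y | ‖y j‖ ≤ s}) ∩ {y | s < ‖y 0‖} := by
    ext y
    simp [firstExcWindow]
  rw [h]
  refine (MeasurableSet.iInter fun j => .iInter fun _ => .iInter fun _ => ?_).inter
    (measurableSet_lt_norm_zero s)
  exact measurableSet_le (by fun_prop) measurable_const

variable [SecondCountableTopology E] {ν : Measure (ℤ → E)}

/-- Dominated convergence with bound `‖f‖` on `{ε < ‖y 0‖}`. The support in `ℓ₀` is what makes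
truncated classes converge; an exceedance before time zero is seen once the left end has passed it.
-/
theorem tendsto_integral_firstExcWindow (hν : FiniteAwayFromZero ν)
    (hsupp : ∀ᵐ y ∂ν, y ∈ ell0 E) (f : BoundedContinuousFunction (ClusterSpace E) ℝ) {ε : ℝ}
    (hε : 0 < ε) :
    Tendsto (fun p : ℕ × ℕ => ∫ y, (firstExcWindow E ε p.1).indicator
        (fun z => f (toCluster (trunc (-p.1) p.2 z))) y ∂ν) (atTop ×ˢ atTop)
      (𝓝 (∫ y in firstExc E ε, f (toCluster y) ∂ν)) := by
  rw [← integral_indicator (measurableSet_firstExc ε)]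
  refine tendsto_integral_filter_of_dominated_convergence
    ({y : ℤ → E | ε < ‖y 0‖}.indicator fun _ => ‖f‖) (Eventually.of_forall fun p => ?_)
    (Eventually.of_forall fun p => Eventually.of_forall fun y => ?_)
    ((integrable_indicator_iff (measurableSet_lt_norm_zero ε)).2
      (integrableOn_const (hν.finite 0 ε hε).ne)) ?_
  · exact ((f.continuous.comp (continuous_toCluster_trunc _ _)).measurable.indicator
      (measurableSet_firstExcWindow ε p.1)).aestronglyMeasurable
  · by_cases hy : y ∈ firstExcWindow E ε p.1
    · rw [Set.indicator_of_mem hy, Set.indicator_of_mem (s := {y : ℤ → E | ε < ‖y 0‖}) hy.2]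
      exact f.norm_coe_le_norm _
    · rw [Set.indicator_of_notMem hy, norm_zero]
      exact Set.indicator_nonneg (fun _ _ => norm_nonneg _) _
  · filter_upwards [hsupp] with y hy
    by_cases hmem : y ∈ firstExc E ε
    · rw [Set.indicator_of_mem hmem]
      refine Tendsto.congr (fun p => (Set.indicator_of_mem (s := firstExcWindow E ε p.1)
        ⟨fun i _ h2 => hmem.1 i h2, hmem.2⟩ _).symm) ?_
      exact (f.continuous.tendsto _).comp (tendsto_toCluster_trunc hy)
    · rw [Set.indicator_of_notMem hmem]
      refine tendsto_const_nhds.congr' ?_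
      by_cases h0 : ε < ‖y 0‖
      · obtain ⟨j, hj, hlt⟩ : ∃ j : ℤ, j ≤ -1 ∧ ε < ‖y j‖ := by
          by_contra! hcon
          exact hmem ⟨hcon, h0⟩
        filter_upwards [tendsto_fst.eventually (eventually_ge_atTop j.natAbs)] with p hp
        refine (Set.indicator_of_notMem (fun h => ?_) _).symm
        have := h.1 j (by omega) hj
        linarith
      · exact Eventually.of_forall fun p =>
          (Set.indicator_of_notMem (fun h => h0 h.2) _).symm

/-- The normalized cluster measure of the tail measure for the window `[1, r]`. -/
noncomputable def tailClusterMeasure (ν : Measure (ℤ → E)) (r : ℕ) : Measure (ClusterSpace E) :=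
  (r : ℝ≥0∞)⁻¹ • ν.map fun y => toCluster (trunc 1 r y)

theorem integral_tailClusterMeasure (ν : Measure (ℤ → E)) (r : ℕ)
    (f : BoundedContinuousFunction (ClusterSpace E) ℝ) :
    ∫ a, f a ∂(tailClusterMeasure ν r) = (r : ℝ)⁻¹ * ∫ y, f (toCluster (trunc 1 r y)) ∂ν := by
  rw [tailClusterMeasure, integral_smul_measure, integral_map
    (continuous_toCluster_trunc 1 r).measurable.aemeasurable f.continuous.aestronglyMeasurable,
    ENNReal.toReal_inv, ENNReal.toReal_natCast, smul_eq_mul]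

theorem isBoundedlyFinite_tailClusterMeasure (hν : FiniteAwayFromZero ν) {r : ℕ} (hr : 1 ≤ r) :
    IsBoundedlyFinite (tailClusterMeasure ν r) := by
  rintro A hA ⟨ε, hε, hAε⟩
  rw [tailClusterMeasure, Measure.smul_apply, smul_eq_mul,
    Measure.map_apply (continuous_toCluster_trunc 1 r).measurable hA]
  refine ENNReal.mul_lt_top (by simp; omega) (lt_of_le_of_lt (measure_mono fun y hy => ?_)
    (hν.finite_window r hε))
  intro hcon
  refine not_lt.2 ?_ (hAε _ hy)
  refine (sup_toCluster_le_iff (trunc_mem_ell0 _ _ _) hε.le).2 fun j => ?_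
  by_cases h : 1 ≤ j ∧ j ≤ (r : ℤ)
  · rw [trunc_apply_of_mem h]
    exact hcon j (by omega) h.2
  · rw [trunc_apply_of_not_mem h, norm_zero]
    exact hε.le

/-- The pathwise decomposition by the first exceedance, integrated; shift invariance removes the
shift from each term. -/
theorem integral_toCluster_trunc_eq_sum (hν : FiniteAwayFromZero ν)
    (hinv : ∀ k, ν.map (seqShift k) = ν)
    {f : BoundedContinuousFunction (ClusterSpace E) ℝ} {ε : ℝ}
    (hε : 0 < ε) (hf : ∀ a : ClusterSpace E, a.sup ≤ ε → f a = 0) (r : ℕ) :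
    ∫ y, f (toCluster (trunc 1 r y)) ∂ν = ∑ j ∈ Finset.range r,
      ∫ y, (firstExcWindow E ε j).indicator
        (fun z => f (toCluster (trunc (-j) (r - 1 - j : ℕ) z))) y ∂ν := by
  have hm : ∀ j : ℕ, AEStronglyMeasurable ((firstExcWindow E ε j).indicator
      fun z => f (toCluster (trunc (-j) (r - 1 - j : ℕ) z))) ν := fun j =>
    ((f.continuous.comp (continuous_toCluster_trunc _ _)).measurable.indicator
      (measurableSet_firstExcWindow ε j)).aestronglyMeasurable
  have hint : ∀ j : ℕ, Integrable ((firstExcWindow E ε j).indicator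
      fun z => f (toCluster (trunc (-j) (r - 1 - j : ℕ) z))) ν := fun j => by
    refine hν.integrable_of_window (hm j) (C := ‖f‖) (fun y => ?_) (n := 0) hε fun y hy => ?_
    · by_cases hy : y ∈ firstExcWindow E ε j
      · rw [Set.indicator_of_mem hy]
        exact f.norm_coe_le_norm _
      · rw [Set.indicator_of_notMem hy, abs_zero]
        exact norm_nonneg _
    · exact Set.indicator_of_notMem (fun h => not_lt.2 (hy 0 (by simp) (by simp)) h.2) _
  have hms : ∀ k : ℤ, Measurable (seqShift k : (ℤ → E) → ℤ → E) := fun k =>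
    (continuous_seqShift k).measurable
  have hj : ∀ j : ℕ, ∫ y, (firstExcWindow E ε j).indicator
        (fun z => f (toCluster (trunc (-j) (r - 1 - j : ℕ) z))) y ∂ν =
      ∫ y, (firstExcWindow E ε j).indicator
        (fun z => f (toCluster (trunc (-j) (r - 1 - j : ℕ) z))) (seqShift (-(j + 1)) y) ∂ν := by
    intro j
    nth_rewrite 1 [← hinv (-(j + 1))]
    refine integral_map (hms _).aemeasurable ?_
    rw [hinv]
    exact hm j
  simp only [hj]
  rw [← integral_finsetSum]
  · refine integral_congr_ae (Eventually.of_forall fun y => ?_)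
    exact (sum_indicator_firstExcWindow hε hf r y).symm
  · intro j _
    have h := hint j
    rw [← hinv (-(j + 1))] at h
    exact h.comp_measurable (hms _)

variable [NormedSpace ℝ E]

/-- `lintegral_nuStar` applied to indicators identifies two measures on `{ε < sup}`, and the
function `f`, possibly signed, vanishes elsewhere. -/
theorem integral_nuStar (hf : FiniteAwayFromZero ν)
    (hinv : ∀ k, ν.map (seqShift k) = ν) (hsupp : ∀ᵐ y ∂ν, y ∈ ell0 E) {α : ℝ} (hα : 0 < α)
    (hhom : ∀ c : ℝ, 0 < c → ν.map (fun y => c • y) = ENNReal.ofReal (c ^ α) • ν)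
    (f : BoundedContinuousFunction (ClusterSpace E) ℝ) {ε : ℝ} (hε : 0 < ε)
    (hfε : ∀ a : ClusterSpace E, a.sup ≤ ε → f a = 0) :
    ∫ a, f a ∂(nuStar α (ν.restrict {y | 1 < ‖y 0‖})) =
      ∫ y in firstExc E ε, f (toCluster y) ∂ν := by
  have hA : MeasurableSet {a : ClusterSpace E | ε < a.sup} :=
    measurableSet_lt measurable_const ClusterSpace.continuous_sup.measurable
  have hmeq : (nuStar α (ν.restrict {y | 1 < ‖y 0‖})).restrict {a : ClusterSpace E | ε < a.sup} =
      ((ν.restrict (firstExc E ε)).map toCluster).restrict {a : ClusterSpace E | ε < a.sup} := by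
    refine Measure.ext fun B hB => ?_
    have h := lintegral_nuStar hf hinv hsupp hα hhom
      (g := (B ∩ {a : ClusterSpace E | ε < a.sup}).indicator 1)
      (measurable_one.indicator (hB.inter hA)) hε fun a ha =>
        Set.indicator_of_notMem (fun h => not_lt.2 ha h.2) _
    rw [lintegral_indicator_one (hB.inter hA), ← lintegral_map
      (measurable_one.indicator (hB.inter hA)) measurable_toCluster,
      lintegral_indicator_one (hB.inter hA)] at h
    rw [Measure.restrict_apply hB, Measure.restrict_apply hB, h]
  have hset : ∀ m : Measure (ClusterSpace E),
      ∫ a, f a ∂m = ∫ a in {a : ClusterSpace E | ε < a.sup}, f a ∂m := fun m =>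
    (setIntegral_eq_integral_of_forall_compl_eq_zero fun a ha => hfε a (not_lt.1 ha)).symm
  rw [hset, hmeq, ← hset, integral_map measurable_toCluster.aemeasurable
    f.continuous.aestronglyMeasurable]

theorem isBoundedlyFinite_nuStar (hf : FiniteAwayFromZero ν)
    (hinv : ∀ k, ν.map (seqShift k) = ν) (hsupp : ∀ᵐ y ∂ν, y ∈ ell0 E) {α : ℝ} (hα : 0 < α)
    (hhom : ∀ c : ℝ, 0 < c → ν.map (fun y => c • y) = ENNReal.ofReal (c ^ α) • ν) :
    IsBoundedlyFinite (nuStar α (ν.restrict {y | 1 < ‖y 0‖})) := by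
  rintro A hA ⟨ε, hε, hAε⟩
  have h := lintegral_nuStar hf hinv hsupp hα hhom (g := A.indicator 1)
    (measurable_one.indicator hA) hε fun a ha =>
      Set.indicator_of_notMem (fun h => not_lt.2 ha (hAε a h)) _
  rw [lintegral_indicator_one hA] at h
  rw [h]
  calc ∫⁻ y in firstExc E ε, A.indicator 1 (toCluster y) ∂ν
      ≤ ∫⁻ _ in firstExc E ε, 1 ∂ν :=
        lintegral_mono fun y => Set.indicator_le_self' (fun _ _ => zero_le_one) _
    _ = ν (firstExc E ε) := setLIntegral_one _
    _ < ∞ := lt_of_le_of_lt (measure_mono fun y hy => hy.2) (hf.finite 0 ε hε)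

/-- The cluster measures of the tail measure converge to `ν*` as the window grows. -/
theorem tendsto_integral_tailClusterMeasure (hν : FiniteAwayFromZero ν)
    (hinv : ∀ k, ν.map (seqShift k) = ν) (hsupp : ∀ᵐ y ∂ν, y ∈ ell0 E) {α : ℝ} (hα : 0 < α)
    (hhom : ∀ c : ℝ, 0 < c → ν.map (fun y => c • y) = ENNReal.ofReal (c ^ α) • ν)
    (f : BoundedContinuousFunction (ClusterSpace E) ℝ) {ε : ℝ} (hε : 0 < ε)
    (hf : ∀ a : ClusterSpace E, a.sup ≤ ε → f a = 0) :
    Tendsto (fun r => ∫ a, f a ∂(tailClusterMeasure ν r)) atTop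
      (𝓝 (∫ a, f a ∂(nuStar α (ν.restrict {y | 1 < ‖y 0‖})))) := by
  rw [integral_nuStar hν hinv hsupp hα hhom f hε hf]
  have hlim := tendsto_integral_firstExcWindow hν hsupp f hε
  simp only [integral_tailClusterMeasure, integral_toCluster_trunc_eq_sum hν hinv hε hf]
  set l := ∫ y in firstExc E ε, f (toCluster y) ∂ν
  -- Here `a = j` and `b = r - 1 - j` are the distances from the anchor to the two ends of the
  -- window.
  refine tendsto_average_antidiagonal (h := fun a b => ∫ y, (firstExcWindow E ε a).indicator
    (fun z => f (toCluster (trunc (-a) b z))) y ∂ν) (C := ‖f‖ * ν.real {y | ε < ‖y 0‖} + |l|)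
    (fun a b => (abs_sub _ _).trans (add_le_add_left ?_ _)) hlim
  rw [integral_indicator (measurableSet_firstExcWindow ε a)]
  have hsub : firstExcWindow E ε a ⊆ {y | ε < ‖y 0‖} := fun y hy => hy.2
  refine (norm_setIntegral_le_of_norm_le_const
    (lt_of_le_of_lt (measure_mono hsub) (hν.finite 0 ε hε))
    fun y _ => f.norm_coe_le_norm _).trans ?_
  gcongr
  exact (hν.finite 0 ε hε).ne

end ClusterLimit

/-! ### Metrizability and diagonal selection -/

section Diagonal

/-- A sequence of indices that tends to infinity so slowly that it respects countably many
eventual properties. -/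
theorem exists_monotone_tendsto_eventually {p : ℕ → ℕ → Prop} (h : ∀ m, ∀ᶠ n in atTop, p m n) :
    ∃ R : ℕ → ℕ, Monotone R ∧ Tendsto R atTop atTop ∧ ∀ᶠ n in atTop, p (R n) n := by
  choose N hN using fun m => eventually_atTop.1 (h m)
  -- The sum makes `M m ≥ N m`; the summand `m` makes `M m ≤ n` imply `m ≤ n`, so that the search
  -- bounded by `n` finds every admissible index.
  let M : ℕ → ℕ := fun m => m + ∑ i ∈ Finset.range (m + 1), N i
  have hNM : ∀ m, N m ≤ M m := fun m =>
    (Finset.single_le_sum (f := N) (fun _ _ => Nat.zero_le _) (Finset.self_mem_range_succ m)).trans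
      (Nat.le_add_left _ _)
  have hR : ∀ m n, M m ≤ n → m ≤ Nat.findGreatest (fun m => M m ≤ n) n := fun m n hmn =>
    Nat.le_findGreatest ((Nat.le_add_right _ _).trans hmn) hmn
  refine ⟨fun n => Nat.findGreatest (fun m => M m ≤ n) n, fun a b hab => ?_, ?_, ?_⟩
  · exact Nat.findGreatest_mono (fun m hm => le_trans hm hab) hab
  · refine tendsto_atTop.2 fun m => ?_
    filter_upwards [eventually_ge_atTop (M m)] with n hn using hR m n hn
  · filter_upwards [eventually_ge_atTop (M 0)] with n hn
    refine hN _ n ((hNM _).trans ?_)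
    exact Nat.findGreatest_spec (P := fun m => M m ≤ n) (Nat.zero_le n) hn

/-- Mass and normalization embed nonzero finite measures into a product with the probability
measures, which are pseudometrizable. Normalization breaks down at the zero measure, so a fixed
Dirac mass is added first; it is subtracted again at the level of integrals. -/
instance pseudoMetrizableSpace_finiteMeasure {S : Type*} [TopologicalSpace S]
    [TopologicalSpace.PseudoMetrizableSpace S] [TopologicalSpace.SeparableSpace S]
    [MeasurableSpace S] [BorelSpace S] [Nonempty S] :
    TopologicalSpace.PseudoMetrizableSpace (FiniteMeasure S) := by
  obtain ⟨s⟩ := ‹Nonempty S›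
  let δ : FiniteMeasure S := ⟨Measure.dirac s, inferInstance⟩
  let G : FiniteMeasure S → NNReal × ProbabilityMeasure S := fun m =>
    ((m + δ).mass, (m + δ).normalize)
  have hne : ∀ m : FiniteMeasure S, m + δ ≠ 0 := by
    intro m h0
    have h1 : ((m + δ : FiniteMeasure S) : Measure S) Set.univ = 0 := by
      rw [h0, FiniteMeasure.toMeasure_zero, Measure.coe_zero, Pi.zero_apply]
    rw [FiniteMeasure.toMeasure_add, Measure.add_apply, add_eq_zero] at h1
    have h2 : (δ : Measure S) Set.univ = 1 := measure_univ (μ := Measure.dirac s)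
    exact one_ne_zero (h2.symm.trans h1.2)
  have hind : IsInducing G := by
    rw [isInducing_iff_nhds]
    intro m
    refine le_antisymm ?_ ?_
    · rw [← tendsto_iff_comap]
      have hadd : Tendsto (fun m' : FiniteMeasure S => m' + δ) (𝓝 m) (𝓝 (m + δ)) :=
        (continuous_id.add continuous_const).tendsto m
      exact (hadd.mass).prodMk_nhds
        ((FiniteMeasure.tendsto_normalize_iff_tendsto (hne m)).2 hadd).1
    · have h : Tendsto G (comap G (𝓝 (G m))) (𝓝 (G m)) := tendsto_comap
      have hadd := (FiniteMeasure.tendsto_normalize_iff_tendsto (hne m)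
        (μs := fun m' : FiniteMeasure S => m' + δ)).1
          ⟨((Prod.tendsto_iff _ _).1 h).2, ((Prod.tendsto_iff _ _).1 h).1⟩
      rw [← tendsto_id']
      rw [FiniteMeasure.tendsto_iff_forall_integral_tendsto] at hadd ⊢
      intro f
      have hsplit : ∀ m' : FiniteMeasure S, ∫ x, f x ∂((m' + δ : FiniteMeasure S) : Measure S) =
          ∫ x, f x ∂(m' : Measure S) + ∫ x, f x ∂(δ : Measure S) := fun m' => by
        rw [FiniteMeasure.toMeasure_add, integral_add_measure (f.integrable _) (f.integrable _)]
      have := (hadd f).sub_const (∫ x, f x ∂(δ : Measure S))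
      simp only [hsplit, add_sub_cancel_right] at this
      exact this
  exact hind.pseudoMetrizableSpace

variable {E : Type*} [NormedAddCommGroup E]

instance : Nonempty (ClusterSpace E) := ⟨ClusterSpace.mk 0⟩

/-- A continuous weight with values in `[0, 1]`, zero near the zero class and one away from it. -/
noncomputable def weight (k : ℕ) : BoundedContinuousFunction (ClusterSpace E) ℝ :=
  BoundedContinuousFunction.ofNormedAddCommGroup
    (fun a => min 1 (max 0 ((k + 1) * a.sup - 1)))
    (by have := ClusterSpace.continuous_sup (E := E); fun_prop) 1 fun a => by
      rw [Real.norm_of_nonneg (le_min zero_le_one (le_max_left _ _))]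
      exact min_le_left _ _

theorem weight_nonneg (k : ℕ) (a : ClusterSpace E) : 0 ≤ weight k a :=
  le_min zero_le_one (le_max_left _ _)

theorem weight_le_one (k : ℕ) (a : ClusterSpace E) : weight k a ≤ 1 := min_le_left _ _

theorem weight_eq_zero {k : ℕ} {a : ClusterSpace E} (h : a.sup ≤ 1 / (k + 1)) : weight k a = 0 := by
  have : (k + 1) * a.sup ≤ 1 := by
    rwa [le_div_iff₀ (by positivity), mul_comm] at h
  exact (congrArg (min 1) (max_eq_left (by linarith))).trans (min_eq_right zero_le_one)

theorem weight_eq_one {k : ℕ} {a : ClusterSpace E} (h : 2 / (k + 1) ≤ a.sup) : weight k a = 1 := by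
  have : 2 ≤ (k + 1) * a.sup := by
    rwa [div_le_iff₀ (by positivity), mul_comm] at h
  exact min_eq_left (le_max_of_le_right (by linarith))

theorem isFiniteMeasure_weight {μ : Measure (ClusterSpace E)} (hμ : IsBoundedlyFinite μ) (k : ℕ) :
    IsFiniteMeasure (μ.withDensity fun a => ENNReal.ofReal (weight k a)) := by
  have hpos : (0 : ℝ) < 1 / (k + 1) := by positivity
  have hA : MeasurableSet {a : ClusterSpace E | 1 / ((k : ℝ) + 1) < a.sup} :=
    measurableSet_lt measurable_const ClusterSpace.continuous_sup.measurable
  refine ⟨?_⟩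
  rw [withDensity_apply _ .univ, Measure.restrict_univ]
  calc ∫⁻ a, ENNReal.ofReal (weight k a) ∂μ
      ≤ ∫⁻ a, {a : ClusterSpace E | 1 / ((k : ℝ) + 1) < a.sup}.indicator 1 a ∂μ := by
        refine lintegral_mono fun a => ?_
        by_cases ha : 1 / ((k : ℝ) + 1) < a.sup
        · rw [Set.indicator_of_mem (s := {a : ClusterSpace E | 1 / ((k : ℝ) + 1) < a.sup}) ha]
          simpa using weight_le_one k a
        · rw [weight_eq_zero (not_lt.1 ha), ENNReal.ofReal_zero]
          exact zero_le
    _ = μ {a : ClusterSpace E | 1 / ((k : ℝ) + 1) < a.sup} := lintegral_indicator_one hA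
    _ < ∞ := hμ _ hA ⟨_, hpos, fun a ha => ha⟩

/-- A boundedly finite measure, weighted to become finite. -/
noncomputable def weightedMeasure (μ : Measure (ClusterSpace E)) (hμ : IsBoundedlyFinite μ)
    (k : ℕ) : FiniteMeasure (ClusterSpace E) :=
  ⟨μ.withDensity fun a => ENNReal.ofReal (weight k a), isFiniteMeasure_weight hμ k⟩

theorem integral_weightedMeasure {μ : Measure (ClusterSpace E)} (hμ : IsBoundedlyFinite μ)
    (k : ℕ) (f : BoundedContinuousFunction (ClusterSpace E) ℝ) :
    ∫ a, f a ∂(weightedMeasure μ hμ k : Measure (ClusterSpace E)) =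
      ∫ a, weight k a * f a ∂μ := by
  change ∫ a, f a ∂(μ.withDensity fun a => ENNReal.ofReal (weight k a)) = _
  rw [integral_withDensity_eq_integral_toReal_smul
    (weight k).continuous.measurable.ennreal_ofReal (by simp)]
  simp only [ENNReal.toReal_ofReal (weight_nonneg k _), smul_eq_mul]

/-- The convergence of integrals in the definition of `M₀`. -/
def TendstoIntegrals (μ : ℕ → Measure (ClusterSpace E)) (μ' : Measure (ClusterSpace E)) : Prop :=
  ∀ f : BoundedContinuousFunction (ClusterSpace E) ℝ, ∀ ε > 0,
    (∀ a : ClusterSpace E, a.sup ≤ ε → f a = 0) →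
      Tendsto (fun n => ∫ a, f a ∂(μ n)) atTop (𝓝 (∫ a, f a ∂μ'))

theorem TendstoIntegrals.weightedMeasure {μ : ℕ → Measure (ClusterSpace E)}
    {μ' : Measure (ClusterSpace E)} (h : TendstoIntegrals μ μ') (hμ : ∀ n, IsBoundedlyFinite (μ n))
    (hμ' : IsBoundedlyFinite μ') (k : ℕ) :
    Tendsto (fun n => weightedMeasure (μ n) (hμ n) k) atTop (𝓝 (weightedMeasure μ' hμ' k)) := by
  rw [FiniteMeasure.tendsto_iff_forall_integral_tendsto]
  intro f
  simp only [integral_weightedMeasure]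
  refine h ((weight k : BoundedContinuousFunction (ClusterSpace E) ℝ) * f) (1 / (k + 1)) (by positivity)
    fun a ha => ?_
  rw [BoundedContinuousFunction.mul_apply, weight_eq_zero ha, zero_mul]

/-- A function that vanishes for `sup ≤ ε` is unchanged by the weight `k` as soon as `2 / (k + 1) <
ε`. Countably many weak convergences therefore suffice. -/
theorem tendstoIntegrals_of_weightedMeasure {μ : ℕ → Measure (ClusterSpace E)}
    {μ' : Measure (ClusterSpace E)} (hμ : ∀ n, IsBoundedlyFinite (μ n))
    (hμ' : IsBoundedlyFinite μ')
    (h : ∀ k, Tendsto (fun n => weightedMeasure (μ n) (hμ n) k) atTop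
      (𝓝 (weightedMeasure μ' hμ' k))) : TendstoIntegrals μ μ' := by
  intro f ε hε hf
  obtain ⟨k, hk⟩ := exists_nat_one_div_lt (half_pos hε)
  have hwf : ∀ a, weight k a * f a = f a := by
    intro a
    by_cases ha : a.sup ≤ ε
    · rw [hf a ha, mul_zero]
    · rw [weight_eq_one, one_mul]
      rw [← mul_one_div]
      linarith
  have := (FiniteMeasure.tendsto_iff_forall_integral_tendsto.1 (h k)) f
  simpa only [integral_weightedMeasure, hwf] using this

variable [SecondCountableTopology E]

/-- Diagonal selection for convergence in `M₀`. -/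
theorem exists_diagonal_tendstoM0 {μ : ℕ → ℕ → Measure (ClusterSpace E)}
    {μ₁ : ℕ → Measure (ClusterSpace E)} {μ₂ : Measure (ClusterSpace E)}
    (hμ : ∀ m n, IsBoundedlyFinite (μ m n)) (hμ₁ : ∀ m, IsBoundedlyFinite (μ₁ m))
    (hμ₂ : IsBoundedlyFinite μ₂) (h : ∀ m, TendstoIntegrals (μ m) (μ₁ m))
    (h₁ : TendstoIntegrals μ₁ μ₂) {v : ℕ → ℕ → ℝ} (hv : ∀ m, Tendsto (v m) atTop (𝓝 0)) :
    ∃ R : ℕ → ℕ, Monotone R ∧ Tendsto R atTop atTop ∧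
      Tendsto (fun n => v (R n) n) atTop (𝓝 0) ∧ TendstoM0 (fun n => μ (R n) n) μ₂ := by
  let _ : PseudoMetricSpace (FiniteMeasure (ClusterSpace E)) :=
    TopologicalSpace.pseudoMetrizableSpacePseudoMetric _
  -- Stage `m` controls only the first `m + 1` weights, so each condition is a finite conjunction;
  -- every fixed weight is eventually covered because `R n → ∞`.
  obtain ⟨R, hR, hRt, hRp⟩ := exists_monotone_tendsto_eventually (p := fun m n =>
    (∀ k ∈ Finset.range (m + 1), dist (weightedMeasure (μ m n) (hμ m n) k)
      (weightedMeasure (μ₁ m) (hμ₁ m) k) < 1 / (m + 1)) ∧ dist (v m n) 0 < 1 / (m + 1))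
    fun m => by
      have hpos : (0 : ℝ) < 1 / (m + 1) := by positivity
      refine Eventually.and ?_ (Metric.tendsto_nhds.1 (hv m) _ hpos)
      rw [Finset.eventually_all]
      exact fun k _ => Metric.tendsto_nhds.1
        ((h m).weightedMeasure (hμ m) (hμ₁ m) k) _ hpos
  have hz : Tendsto (fun n => 1 / ((R n : ℝ) + 1)) atTop (𝓝 0) :=
    tendsto_one_div_add_atTop_nhds_zero_nat.comp hRt
  refine ⟨R, hR, hRt, ?_, fun n => hμ _ _, hμ₂, ?_⟩
  · rw [tendsto_iff_dist_tendsto_zero]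
    refine squeeze_zero' (Eventually.of_forall fun n => dist_nonneg) ?_ hz
    filter_upwards [hRp] with n hn using hn.2.le
  · suffices hI : TendstoIntegrals (fun n => μ (R n) n) μ₂ by
      rintro f ⟨ε, hε, hf⟩
      exact hI f ε hε hf
    refine tendstoIntegrals_of_weightedMeasure (fun n => hμ _ _) hμ₂ fun k => ?_
    have h2 := ((h₁.weightedMeasure hμ₁ hμ₂ k).comp hRt)
    rw [tendsto_iff_dist_tendsto_zero] at h2 ⊢
    have h3 := hz.add h2
    rw [add_zero] at h3
    refine squeeze_zero' (Eventually.of_forall fun n => dist_nonneg) ?_ h3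
    filter_upwards [hRp, hRt.eventually_ge_atTop k] with n hn hk
    exact (dist_triangle _ _ _).trans
      (add_le_add_left (hn.1 k (Finset.mem_range.2 (by omega))).le _)

end Diagonal

/-! ### Cluster measures of the series for a fixed window -/

section ClusterConvergence

theorem measurable_smul_path {Ω : Type*} [MeasurableSpace Ω] {E : Type*} [NormedAddCommGroup E]
    [NormedSpace ℝ E] [MeasurableSpace E] [BorelSpace E] {X : ℤ → Ω → E}
    (hmeas : ∀ j, Measurable (X j)) (c : ℝ) :
    Measurable fun ω (j : ℤ) => c⁻¹ • X j ω :=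
  measurable_pi_lambda _ fun j => (hmeas j).const_smul _

variable {Ω : Type*} [MeasurableSpace Ω] {E : Type*} [NormedAddCommGroup E] [NormedSpace ℝ E]
  [MeasurableSpace E] [BorelSpace E] [SecondCountableTopology E]
  {P : Measure Ω} {X : ℤ → Ω → E} {ν : Measure (ℤ → E)}

/-- Convergence of the cluster measures for a fixed window. -/
theorem tendstoIntegrals_clusterMeasure (hν : IsTailMeasure P X ν)
    (hmeas : ∀ j, Measurable (X j)) {c : ℕ → ℝ} (hc : Tendsto c atTop atTop) (r : ℕ) :
    TendstoIntegrals (fun n => clusterMeasure P X (c n) r) (tailClusterMeasure ν r) := by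
  intro f ε hε hf
  rw [integral_tailClusterMeasure]
  refine (((hν.tendsto_test (isTest_toCluster_trunc hε hf r)).comp hc).const_mul
    (r : ℝ)⁻¹).congr fun n => ?_
  have hm : Measurable fun ω => toCluster (cluster X (c n) r ω) :=
    (continuous_toCluster_trunc 1 r).measurable.comp (measurable_smul_path hmeas (c n))
  unfold clusterMeasure
  rw [integral_smul_measure, integral_map hm.aemeasurable
    f.continuous.aestronglyMeasurable, ENNReal.toReal_inv, ENNReal.toReal_mul,
    ENNReal.toReal_natCast, smul_eq_mul, mul_inv, mul_assoc, Function.comp_apply, div_eq_inv_mul]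
  rfl

variable [IsProbabilityMeasure P]

/-- The measure is finite outright, provided the normalizing constant is not zero, since its inverse
would then be infinite; hence the need for `1 ≤ r` and a positive tail. -/
theorem isBoundedlyFinite_clusterMeasure (hν : IsTailMeasure P X ν) (c : ℝ) {r : ℕ} (hr : 1 ≤ r) :
    IsBoundedlyFinite (clusterMeasure P X c r) := by
  intro A _ _
  rw [clusterMeasure, Measure.smul_apply, smul_eq_mul]
  refine ENNReal.mul_lt_top (ENNReal.inv_lt_top.2 (ENNReal.mul_pos ?_ ?_)) ?_
  · simp only [ne_eq, Nat.cast_eq_zero]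
    omega
  · intro h0
    have := hν.tail_pos c
    rw [measureReal_def, h0, ENNReal.toReal_zero] at this
    exact lt_irrefl _ this
  · have : IsFiniteMeasure (P.map fun ω => toCluster (cluster X c r ω)) := inferInstance
    exact measure_lt_top _ _

end ClusterConvergence

end TailProcess

/-! ### Assembly of the two limits -/

theorem mainTheorem3 {Ω : Type*} [MeasurableSpace Ω] (P : Measure Ω) [IsProbabilityMeasure P]
    {E : Type*} [NormedAddCommGroup E] [NormedSpace ℝ E] [FiniteDimensional ℝ E]
    [MeasurableSpace E] [BorelSpace E]
    (X : ℤ → Ω → E) (hmeas : ∀ j, Measurable (X j))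
    (hstat : TailProcess.IsStationary P X) (hrv : TailProcess.IsRegularlyVarying P X)
    (ν : Measure (ℤ → E)) (hν : TailProcess.IsTailMeasure P X ν)
    (hsupp : ν (TailProcess.ell0 E)ᶜ = 0) :
    ∃ (α : ℝ) (μY : Measure (ℤ → E)), 0 < α ∧ TailProcess.IsTailProcess P X α μY ∧
      ∀ c : ℕ → ℝ, Tendsto c atTop atTop →
        ∃ r : ℕ → ℕ, Monotone r ∧ (∀ n, 1 ≤ r n) ∧ Tendsto r atTop atTop ∧
          Tendsto (fun n => (r n : ℝ) * P.real {ω | c n < ‖X 0 ω‖}) atTop (𝓝 0) ∧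
          TailProcess.TendstoM0 (fun n => TailProcess.clusterMeasure P X (c n) (r n))
            (TailProcess.nuStar α μY) := by
  have : ProperSpace E := FiniteDimensional.proper ℝ E
  have : SecondCountableTopology E := inferInstance
  obtain ⟨α, hα, hlim⟩ := hν.exists_index
  have hf := hν.finiteAwayFromZero
  have hinv := hν.map_seqShift hmeas hstat
  have hhom := fun c hc => hν.map_smul hlim (c := c) hc
  have hae : ∀ᵐ y ∂ν, y ∈ TailProcess.ell0 E := hsupp
  refine ⟨α, ν.restrict {y | 1 < ‖y 0‖}, hα, hν.isTailProcess hmeas hlim, fun c hc => ?_⟩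
  -- Windows are indexed by `m + 1`, since the empty window would give an infinite normalizing
  -- factor; accordingly `r n = R n + 1`.
  have hlim₁ : TailProcess.TendstoIntegrals (fun m => TailProcess.tailClusterMeasure ν (m + 1))
      (TailProcess.nuStar α (ν.restrict {y | 1 < ‖y 0‖})) := fun f ε hε hfε =>
    (TailProcess.tendsto_integral_tailClusterMeasure hf hinv hae hα hhom f hε hfε).comp
      (tendsto_add_atTop_nat 1)
  obtain ⟨R, hR, hRt, hRv, hRM⟩ := TailProcess.exists_diagonal_tendstoM0
    (μ := fun m n => TailProcess.clusterMeasure P X (c n) (m + 1))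
    (v := fun m n => ((m + 1 : ℕ) : ℝ) * P.real {ω | c n < ‖X 0 ω‖})
    (fun m n => TailProcess.isBoundedlyFinite_clusterMeasure hν (c n) (by omega))
    (fun m => TailProcess.isBoundedlyFinite_tailClusterMeasure hf (by omega))
    (TailProcess.isBoundedlyFinite_nuStar hf hinv hae hα hhom)
    (fun m => TailProcess.tendstoIntegrals_clusterMeasure hν hmeas hc (m + 1)) hlim₁
    (fun m => by
      simpa using ((TailProcess.tendsto_tail_zero hmeas).comp hc).const_mul ((m + 1 : ℕ) : ℝ))
  exact ⟨fun n => R n + 1, fun a b hab => Nat.add_le_add_right (hR hab) 1,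
    fun n => Nat.le_add_left 1 _,
    (tendsto_add_atTop_nat 1).comp hRt, hRv, hRM⟩
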